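/- Let $p$ be a prime, $K\subset\mathbf C_p$ a finite extension of $\mathbf Q_p$ with ring of integers $\mathcal O_K$, maximal ideal $\mathfrak m_K=\pi\mathcal O_K$, residue degree $f$ and ramification index $e$. Let $v_p$, $v_\pi=e\,v_p$ be the additive valuations of $\mathbf C_p$ with $v_p(p)=1$, $v_\pi(\pi)=1$ and value $+\infty$ at $0$. For a power series $F=\sum F_iX^i$ over $\mathcal O_K$ let $\mathrm{wideg}(F)$ be the smallest index $n$, and $\mathrm{Lwideg}(F)$ the largest index $m$ (if it exists), at which the minimum of the values $v_p(F_i)$ is attained. With zeros counted with multiplicity, put $$\mathrm{Res}^o(F,G)=F_n^{N}\prod_{|z|<1,\ F(z)=0}G(z),\qquad \mathrm{Res}^c(F,G)=F_m^{M}\prod_{|z|\le 1,\ F(z)=0}G(z)\qquad(z\in\mathbf C_p),$$ where $n=\mathrm{wideg}(F)$, $N=\mathrm{wideg}(G)$, $m=\mathrm{Lwideg}(F)$, $M=\mathrm{Lwideg}(G)$ (the second for series that converge on $\mathcal O_{\mathbf C_p}$). Put $$\alpha(j)=\sum_{k\ge1}\Big\lfloor\frac{j}{p^{kf}}\Big\rfloor,\quad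 \beta(m)=\min\{j\ge 0:\alpha(j)\ge m\},\quad B(s)=\sum_{m=1}^s\beta(m),$$ $$\alpha'(j)=j+\alpha(j),\quad \beta'(m)=\min\{j\ge 0:\alpha'(j)\ge m\},\quad B'(s)=\sum_{m=1}^s\beta'(m).$$ **Theorem 3.4.** Let $F,G$ be power series with coefficients in $\mathcal O_K$, of finite Weierstrass degrees $\mathrm{wideg}(F)=n$ and $\mathrm{wideg}(G)=N$, such that $F_n$ and $G_N$ are units. (i) Suppose that $F$ and $G$ have no common zero in $\mathfrak m_K$. Then $\phi(x)=\min(v_\pi(F(x)),v_\pi(G(x)))$ has a maximum $S'$ and a minimum $s'$ on $\mathfrak m_K$, both are non-negative integers, and for every integer $t\ge0$ $$v_\pi(\mathrm{Res}^o(F,G))-S'\ \ge\ B'(s'+t)-2B'(t)-s'.$$ Equivalently, with the maximum $S'_K=S'/e$ and the minimum $s'_K=s'/e$ of $\min(v_p(F(x)),v_p(G(x)))$ on $\mathfrak m_K$, $$v_p(\mathrm{Res}^o(F,G))-S'_K\ \ge\ \tfrac1e\big(B'(es'_K+t)-2B'(t)-es'_K\big).$$ (ii) Suppose that $F$ and $G$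 converge on $\mathcal O_{\mathbf C_p}$ and have no common zero in $\mathcal O_K$. Then $\phi$ has a maximum $S$ and a minimum $s$ on $\mathcal O_K$, both are non-negative integers, and for every integer $t\ge0$ $$v_\pi(\mathrm{Res}^c(F,G))-S\ \ge\ B(s+t)-2B(t)-s.$$ Equivalently, with the maximum $S_K=S/e$ and the minimum $s_K=s/e$ of $\min(v_p(F(x)),v_p(G(x)))$ on $\mathcal O_K$, $$v_p(\mathrm{Res}^c(F,G))-S_K\ \ge\ \tfrac1e\big(B(es_K+t)-2B(t)-es_K\big).$$ -/

import Mathlib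

open scoped PowerSeries PadicComplex

noncomputable section

namespace PadicResultant

/-! ### The counting functions -/

/-- `α(j) = ∑_{k ≥ 1} ⌊j / p^{kf}⌋`. For `p ≥ 2` and `f ≥ 1` the terms with `k > j` vanish, so the
sum is taken over `1 ≤ k ≤ j`. -/
def alpha (p f j : ℕ) : ℕ := ∑ k ∈ Finset.Icc 1 j, j / p ^ (k * f)

/-- `β(m) = min {j : α(j) ≥ m}`. -/
def beta (p f m : ℕ) : ℕ := sInf {j | m ≤ alpha p f j}

/-- `B(s) = ∑_{m=1}^{s} β(m)`. -/
def bigB (p f s : ℕ) : ℕ := ∑ m ∈ Finset.Icc 1 s, beta p f m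

/-- `α'(j) = j + ∑_{k ≥ 1} ⌊j / p^{kf}⌋`. -/
def alpha' (p f j : ℕ) : ℕ := j + alpha p f j

/-- `β'(m) = min {j : α'(j) ≥ m}`. -/
def beta' (p f m : ℕ) : ℕ := sInf {j | m ≤ alpha' p f j}

/-- `B'(s) = ∑_{m=1}^{s} β'(m)`. -/
def bigB' (p f s : ℕ) : ℕ := ∑ m ∈ Finset.Icc 1 s, beta' p f m

variable {p : ℕ} [Fact p.Prime]

/-! ### Valuations and power series over `ℂ_p` -/

/-- The additive valuation `v` on `ℂ_p` that extends the `p`-adic one up to scaling and is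
normalized by `v(ϖ) = 1` (for `0 < |ϖ| < 1`): `v(x) = log |x| / log |ϖ|`, and `v(0) = ∞`.
With `ϖ = p` it is `v_p`, with `ϖ` a uniformizer `π` of `K` it is `v_π`. -/
def val (ϖ x : ℂ_[p]) : EReal :=
  open Classical in
  if x = 0 then ⊤ else ((Real.log ‖x‖ / Real.log ‖ϖ‖ : ℝ) : EReal)

/-- The value `F(z) = ∑ F_i z^i`. -/
def evalAt (F : ℂ_[p]⟦X⟧) (z : ℂ_[p]) : ℂ_[p] := ∑' i : ℕ, PowerSeries.coeff i F * z ^ i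

/-- `F` converges at every point of `D`. -/
def ConvergesOn (F : ℂ_[p]⟦X⟧) (D : Set ℂ_[p]) : Prop :=
  ∀ z ∈ D, Summable fun i : ℕ => PowerSeries.coeff i F * z ^ i

/-- The multiplicity of `z` as a zero of `F`: the least `k` with `F^{(k)}(z) ≠ 0`
(the characteristic is zero). -/
def zeroMult (F : ℂ_[p]⟦X⟧) (z : ℂ_[p]) : ℕ :=
  sInf {k | evalAt ((PowerSeries.derivative ℂ_[p])^[k] F) z ≠ 0}

/-- The indices at which the coefficients of `F` have minimal valuation (maximal norm). -/
def minIndices (F : ℂ_[p]⟦X⟧) : Set ℕ :=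
  {n | ∀ i, ‖PowerSeries.coeff i F‖ ≤ ‖PowerSeries.coeff n F‖}

/-- The Weierstrass degree exists, i.e. the minimum of the valuations of the coefficients is
attained. -/
def HasFiniteWideg (F : ℂ_[p]⟦X⟧) : Prop := (minIndices F).Nonempty

/-- The Weierstrass degree for the open unit disc: the smallest index of minimal valuation. -/
def wideg (F : ℂ_[p]⟦X⟧) : ℕ := sInf (minIndices F)

/-- The Weierstrass degree for the closed unit disc: the largest index of minimal valuation. -/
def lwideg (F : ℂ_[p]⟦X⟧) : ℕ := sSup (minIndices F)

/-- The product of the values of `G` at the zeros of `F` in `D`, counted with multiplicity. -/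
def prodOverZeros (D : Set ℂ_[p]) (F G : ℂ_[p]⟦X⟧) : ℂ_[p] :=
  ∏ᶠ z ∈ {z | z ∈ D ∧ evalAt F z = 0}, evalAt G z ^ zeroMult F z

/-- The resultant on the open unit disc, `F_n^N ∏ G(z)` over the zeros `z` of `F` in the open disc,
with `n = wideg F`, `N = wideg G`. -/
def resO (F G : ℂ_[p]⟦X⟧) : ℂ_[p] :=
  PowerSeries.coeff (wideg F) F ^ wideg G * prodOverZeros (Metric.ball 0 1) F G

/-- The resultant on the closed unit disc, `F_m^M ∏ G(z)` over the zeros `z` of `F` in the closed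
disc, with `m = lwideg F`, `M = lwideg G`. -/
def resC (F G : ℂ_[p]⟦X⟧) : ℂ_[p] :=
  PowerSeries.coeff (lwideg F) F ^ lwideg G * prodOverZeros (Metric.closedBall 0 1) F G

/-- `φ(z) = min (v(F(z)), v(G(z)))`, with `v` normalized by `v(ϖ) = 1`. -/
def phi (ϖ : ℂ_[p]) (F G : ℂ_[p]⟦X⟧) (z : ℂ_[p]) : EReal :=
  min (val ϖ (evalAt F z)) (val ϖ (evalAt G z))

/-! ### Finite extensions `K` of `ℚ_p` inside `ℂ_p` -/

/-- The ring of integers `𝒪_K`, as the ring of elements of `K` of norm at most one. -/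
abbrev ringInt (K : IntermediateField ℚ_[p] ℂ_[p]) : ValuationSubring K :=
  (PadicComplexInt p).comap (algebraMap K ℂ_[p])

/-- The inclusion `𝒪_K → ℂ_p`. -/
def incl (K : IntermediateField ℚ_[p] ℂ_[p]) : ringInt K →+* ℂ_[p] :=
  (algebraMap K ℂ_[p]).comp (ringInt K).subtype

/-- A power series over `𝒪_K`, seen over `ℂ_p`. -/
abbrev toCp {K : IntermediateField ℚ_[p] ℂ_[p]} (F : (ringInt K)⟦X⟧) : ℂ_[p]⟦X⟧ :=
  PowerSeries.map (incl K) F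

/-- The residue degree of `K`: the degree of the residue field over its prime field. -/
def residueDeg (K : IntermediateField ℚ_[p] ℂ_[p]) : ℕ :=
  Module.finrank (⊥ : Subfield (IsLocalRing.ResidueField (ringInt K)))
    (IsLocalRing.ResidueField (ringInt K))

/-- The ramification index of `K` with uniformizer `π`: the exact power of `π` dividing `p`. -/
def ramIndex {K : IntermediateField ℚ_[p] ℂ_[p]} (π : ringInt K) : ℕ :=
  multiplicity π (p : ringInt K)

/-- `S` and `s` are the maximum and the minimum of `φ` on `D ∩ K`. -/
def IsMaxMin (K : IntermediateField ℚ_[p] ℂ_[p]) (ϖ : ℂ_[p]) (D : Set ℂ_[p]) (F G : ℂ_[p]⟦X⟧)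
    (S s : ℝ) : Prop :=
  IsGreatest (phi ϖ F G '' (D ∩ (K : Set ℂ_[p]))) (S : EReal) ∧
    IsLeast (phi ϖ F G '' (D ∩ (K : Set ℂ_[p]))) (s : EReal)

end PadicResultant

end

open PadicResultant

/-!
By Weierstrass preparation `F` and `G` may be replaced by monic polynomials `P` and `Q` over `𝒪_K`
with the same zeros in the disc; the absolute value of the resultant becomes that of
`resultant P Q`, the determinant of the Sylvester map `(u, v) ↦ u Q + v P`. Let `s` and `S` be the
extreme values of `φ`, the latter attained at `x₀`. The Sylvester map carries pairs of polynomials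
whose values on the `K`-points of the disc are divisible by `π ^ t` to polynomials whose values are
divisible by `π ^ (s + t)`, and at `x₀` even by `π ^ (S + t)`. Newton polynomials at a Bhargava
`π`-ordering that starts with `x₀` give bases of both lattices, whose determinants are `π` to the
powers `∑ (t - α(j))⁺` and `∑ (s + t - α(j))⁺`, the `j = 0` term of the second being replaced by
`S + t`. Comparing determinants bounds the valuation of the resultant, and counting pairs
`α(j) < m ≤ s` in two ways gives `∑ (s - α(j))⁺ = B(s)`.
-/

namespace PadicResultant

/-! ### Counting functions and their generalized inverses -/

section Counting

theorem galoisConnection_sInf_le {a : ℕ → ℕ} (ha : Monotone a) (hu : ∀ m, ∃ j, m ≤ a j) :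
    GaloisConnection (fun m => sInf {j | m ≤ a j}) a :=
  fun m _ => ⟨fun h => (Nat.sInf_mem (s := {j | m ≤ a j}) (hu m)).trans (ha h),
    fun h => Nat.sInf_le h⟩

theorem alpha_mono (p f : ℕ) : Monotone (alpha p f) := fun i j hij =>
  calc ∑ k ∈ Finset.Icc 1 i, i / p ^ (k * f)
      ≤ ∑ k ∈ Finset.Icc 1 i, j / p ^ (k * f) :=
        Finset.sum_le_sum fun _ _ => Nat.div_le_div_right hij
    _ ≤ ∑ k ∈ Finset.Icc 1 j, j / p ^ (k * f) :=
        Finset.sum_le_sum_of_subset (Finset.Icc_subset_Icc_right hij)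

theorem le_alpha_mul_pow {p : ℕ} (hp : 0 < p) (f m : ℕ) : m ≤ alpha p f (m * p ^ f) := by
  rcases Nat.eq_zero_or_pos m with rfl | hm
  · exact Nat.zero_le _
  have h1 : 1 ∈ Finset.Icc 1 (m * p ^ f) :=
    Finset.mem_Icc.mpr ⟨le_rfl, Nat.mul_pos hm (pow_pos hp f)⟩
  calc m = m * p ^ f / p ^ (1 * f) := by rw [one_mul, Nat.mul_div_cancel _ (pow_pos hp f)]
    _ ≤ alpha p f (m * p ^ f) :=
        Finset.single_le_sum (f := fun k => m * p ^ f / p ^ (k * f)) (fun _ _ => Nat.zero_le _) h1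

theorem galoisConnection_beta {p : ℕ} (hp : 0 < p) (f : ℕ) :
    GaloisConnection (beta p f) (alpha p f) :=
  galoisConnection_sInf_le (alpha_mono p f) fun m => ⟨_, le_alpha_mul_pow hp f m⟩

theorem galoisConnection_beta' (p f : ℕ) : GaloisConnection (beta' p f) (alpha' p f) :=
  galoisConnection_sInf_le (monotone_id.add (alpha_mono p f)) fun m => ⟨m, Nat.le_add_right _ _⟩

variable {a b : ℕ → ℕ}

theorem sum_range_tsub_eq (gc : GaloisConnection b a) (s d : ℕ) :
    ∑ j ∈ Finset.range d, (s - a j) = ∑ m ∈ Finset.Icc 1 s, min d (b m) := by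
  have card_row (j : ℕ) : s - a j = ∑ m ∈ Finset.Icc 1 s, if a j < m then 1 else 0 := by
    have : {m ∈ Finset.Icc 1 s | a j < m} = Finset.Icc (a j + 1) s := by
      ext m; simp only [Finset.mem_filter, Finset.mem_Icc]; omega
    rw [← Finset.card_filter, this, Nat.card_Icc]
    omega
  have card_column (m : ℕ) : min d (b m) = ∑ j ∈ Finset.range d, if a j < m then 1 else 0 := by
    have : {j ∈ Finset.range d | a j < m} = Finset.range (min d (b m)) := by
      ext j; simp only [Finset.mem_filter, Finset.mem_range, lt_min_iff, gc.lt_iff_lt]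
    rw [← Finset.card_filter, this, Finset.card_range]
  simp_rw [card_row, card_column]
  exact Finset.sum_comm

theorem sum_range_tsub_le (gc : GaloisConnection b a) (s d : ℕ) :
    ∑ j ∈ Finset.range d, (s - a j) ≤ ∑ m ∈ Finset.Icc 1 s, b m := by
  rw [sum_range_tsub_eq gc]
  exact Finset.sum_le_sum fun _ _ => min_le_right _ _

theorem sum_range_tsub_eq_of_le (gc : GaloisConnection b a) {s d : ℕ} (hd : s ≤ a d) :
    ∑ j ∈ Finset.range d, (s - a j) = ∑ m ∈ Finset.Icc 1 s, b m := by
  rw [sum_range_tsub_eq gc]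
  exact Finset.sum_congr rfl fun m hm =>
    min_eq_right (gc.l_le ((Finset.mem_Icc.mp hm).2.trans hd))

end Counting

/-! ### Bhargava orderings -/

section Ordering

variable {R : Type*} [CommRing R]

/-- The element `∑ rep (d_k) π ^ k` of `R` attached to the natural number `n = ∑ d_k q ^ k` with
base `q` digits `d_k`. -/
def digitPoint (q : ℕ) (rep : ℕ → R) (π : R) (n : ℕ) : R :=
  ((Nat.digits q n).map rep).foldr (fun c x => c + π * x) 0

/-- `rep` maps `{0, …, q - 1}` bijectively to `R / π`, with `rep 0 = 0` so that leading zeros do not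
change a digit expansion. -/
structure IsDigitSystem (q : ℕ) (rep : ℕ → R) (π : R) : Prop where
  two_le : 2 ≤ q
  rep_zero : rep 0 = 0
  inj : ∀ i < q, ∀ j < q, π ∣ rep i - rep j → i = j
  surj : ∀ x, ∃ i < q, π ∣ x - rep i

theorem exists_isDigitSystem (π : R) [Nontrivial (R ⧸ Ideal.span {π})]
    [Finite (R ⧸ Ideal.span {π})] :
    ∃ rep : ℕ → R, IsDigitSystem (Nat.card (R ⧸ Ideal.span {π})) rep π := by
  set q := Nat.card (R ⧸ Ideal.span {π})
  have hq : 1 < q := Finite.one_lt_card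
  have : NeZero q := ⟨by omega⟩
  let e : Fin q ≃ R ⧸ Ideal.span {π} := (Finite.equivFin _).symm
  let lift : ℕ → R := fun i => (e (Fin.ofNat q i)).out
  have mk_lift (i : ℕ) (hi : i < q) : Ideal.Quotient.mk (Ideal.span {π}) (lift i) = e ⟨i, hi⟩ := by
    rw [Ideal.Quotient.mk_out]
    exact congrArg e (Fin.ext (Nat.mod_eq_of_lt hi))
  have dvd_iff (x y : R) : π ∣ x - y ↔
      Ideal.Quotient.mk (Ideal.span {π}) x = Ideal.Quotient.mk (Ideal.span {π}) y := by
    rw [Ideal.Quotient.eq, Ideal.mem_span_singleton]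
  refine ⟨fun i => lift i - lift 0, hq, sub_self _, fun i hi j hj h => ?_, fun x => ?_⟩
  · rw [sub_sub_sub_cancel_right, dvd_iff, mk_lift i hi, mk_lift j hj] at h
    exact congrArg Fin.val (e.injective h)
  · refine ⟨e.symm (Ideal.Quotient.mk _ (x + lift 0)), Fin.isLt _, ?_⟩
    rw [← sub_add, sub_add_eq_add_sub, dvd_iff, mk_lift _ (Fin.isLt _), Fin.eta,
      Equiv.apply_symm_apply]

theorem digitPoint_zero (q : ℕ) (rep : ℕ → R) (π : R) : digitPoint q rep π 0 = 0 := by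
  rw [digitPoint, Nat.digits_zero, List.map_nil, List.foldr_nil]

theorem IsDigitSystem.digitPoint_eq {q : ℕ} {rep : ℕ → R} {π : R} (H : IsDigitSystem q rep π)
    (n : ℕ) : digitPoint q rep π n = rep (n % q) + π * digitPoint q rep π (n / q) := by
  rcases Nat.eq_zero_or_pos n with rfl | hn
  · rw [Nat.zero_mod, Nat.zero_div, digitPoint_zero, H.rep_zero, mul_zero, add_zero]
  · rw [digitPoint, Nat.digits_def' H.two_le hn, List.map_cons, List.foldr_cons, ← digitPoint]

theorem modEq_pow_succ_iff {q : ℕ} (hq : 0 < q) (k i j : ℕ) :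
    i ≡ j [MOD q ^ (k + 1)] ↔ i % q = j % q ∧ i / q ≡ j / q [MOD q ^ k] := by
  rw [pow_succ']
  constructor
  · intro h
    have hmod : i % q = j % q := h.of_mul_right _
    refine ⟨hmod, ?_⟩
    rw [← Nat.div_add_mod i q, ← Nat.div_add_mod j q, hmod] at h
    exact Nat.ModEq.mul_left_cancel' hq.ne' (Nat.ModEq.add_right_cancel' _ h)
  · rintro ⟨hmod, hdiv⟩
    rw [← Nat.div_add_mod i q, ← Nat.div_add_mod j q, hmod]
    exact (Nat.ModEq.mul_left' q hdiv).add_right _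

variable {q : ℕ} {rep : ℕ → R} {π : R}

theorem IsDigitSystem.exists_pow_dvd_sub_digitPoint (H : IsDigitSystem q rep π) (k : ℕ) (x : R) :
    ∃ r, π ^ k ∣ x - digitPoint q rep π r := by
  have hq : 0 < q := Nat.zero_lt_of_lt H.two_le
  induction k generalizing x with
  | zero => exact ⟨0, by rw [pow_zero]; exact one_dvd _⟩
  | succ k ih =>
    obtain ⟨i, hi, y, hy⟩ := H.surj x
    obtain ⟨r, z, hz⟩ := ih y
    refine ⟨i + q * r, z, ?_⟩
    rw [H.digitPoint_eq, Nat.add_mul_mod_self_left, Nat.mod_eq_of_lt hi,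
      Nat.add_mul_div_left _ _ hq, Nat.div_eq_of_lt hi, zero_add, pow_succ']
    linear_combination hy + π * hz

theorem IsDigitSystem.pow_dvd_digitPoint_sub_iff [IsDomain R] (H : IsDigitSystem q rep π)
    (hπ : π ≠ 0) (k i j : ℕ) :
    π ^ k ∣ digitPoint q rep π i - digitPoint q rep π j ↔ i ≡ j [MOD q ^ k] := by
  have hq : 0 < q := Nat.zero_lt_of_lt H.two_le
  induction k generalizing i j with
  | zero => simp only [pow_zero, isUnit_one, IsUnit.dvd, Nat.modEq_one]
  | succ k ih =>
    have split_digit : digitPoint q rep π i - digitPoint q rep π j = (rep (i % q) - rep (j % q))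
        + π * (digitPoint q rep π (i / q) - digitPoint q rep π (j / q)) := by
      rw [H.digitPoint_eq i, H.digitPoint_eq j]
      ring
    rw [modEq_pow_succ_iff hq, split_digit]
    constructor
    · intro h
      have hrep : π ∣ rep (i % q) - rep (j % q) :=
        (dvd_add_left (dvd_mul_right _ _)).mp ((dvd_pow_self π k.succ_ne_zero).trans h)
      have hmod := H.inj _ (Nat.mod_lt _ hq) _ (Nat.mod_lt _ hq) hrep
      rw [hmod, sub_self, zero_add, pow_succ'] at h
      exact ⟨hmod, (ih _ _).mp ((mul_dvd_mul_iff_left hπ).mp h)⟩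
    · rintro ⟨hmod, hdiv⟩
      rw [hmod, sub_self, zero_add, pow_succ']
      exact mul_dvd_mul_left _ ((ih _ _).mpr hdiv)

theorem card_filter_pow_dvd_le_emultiplicity {M : Type*} [Monoid M] (c x : M) (L : ℕ)
    [DecidablePred fun k => c ^ k ∣ x] :
    ({k ∈ Finset.Icc 1 L | c ^ k ∣ x}.card : ℕ∞) ≤ emultiplicity c x := by
  by_cases hfin : FiniteMultiplicity c x
  · have hsub : {k ∈ Finset.Icc 1 L | c ^ k ∣ x} ⊆ Finset.Icc 1 (multiplicity c x) := fun k hk => by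
      obtain ⟨hk, hdvd⟩ := Finset.mem_filter.mp hk
      exact Finset.mem_Icc.mpr ⟨(Finset.mem_Icc.mp hk).1, hfin.le_multiplicity_of_pow_dvd hdvd⟩
    have hcard := Finset.card_le_card hsub
    rw [Nat.card_Icc, Nat.add_sub_cancel] at hcard
    exact (Nat.cast_le.mpr hcard).trans multiplicity_le_emultiplicity
  · rw [emultiplicity_eq_top.mpr hfin]
    exact le_top

theorem sum_card_filter_modEq {q : ℕ} (hq : 0 < q) (j : ℕ) (r : ℕ → ℕ) :
    ∑ i ∈ Finset.range j, {k ∈ Finset.Icc 1 j | i ≡ r k [MOD q ^ k]}.card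
      = ∑ k ∈ Finset.Icc 1 j, (j / q ^ k + if r k % q ^ k < j % q ^ k then 1 else 0) := by
  simp_rw [Finset.card_filter]
  rw [Finset.sum_comm]
  refine Finset.sum_congr rfl fun k _ => ?_
  rw [← Finset.card_filter, ← Nat.count_eq_card_filter_range, Nat.count_modEq_card _ (pow_pos hq k)]

variable [IsDomain R]

theorem IsDigitSystem.le_emultiplicity_prod_sub (H : IsDigitSystem q rep π) (hπ : Prime π)
    (x : R) (j : ℕ) :
    ((∑ k ∈ Finset.Icc 1 j, j / q ^ k : ℕ) : ℕ∞)
      ≤ emultiplicity π (∏ i ∈ Finset.range j, (x - digitPoint q rep π i)) := by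
  classical
  choose r hr using fun k => H.exists_pow_dvd_sub_digitPoint k x
  have dvd_iff (i k : ℕ) : π ^ k ∣ x - digitPoint q rep π i ↔ i ≡ r k [MOD q ^ k] := by
    rw [← H.pow_dvd_digitPoint_sub_iff hπ.ne_zero, ← dvd_sub_right (hr k), sub_sub_sub_cancel_left]
  calc ((∑ k ∈ Finset.Icc 1 j, j / q ^ k : ℕ) : ℕ∞)
      ≤ (∑ i ∈ Finset.range j, {k ∈ Finset.Icc 1 j | i ≡ r k [MOD q ^ k]}.card : ℕ) := by
        rw [sum_card_filter_modEq (Nat.zero_lt_of_lt H.two_le)]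
        exact Nat.cast_le.mpr (Finset.sum_le_sum fun _ _ => Nat.le_add_right _ _)
    _ ≤ ∑ i ∈ Finset.range j, emultiplicity π (x - digitPoint q rep π i) := by
        simp_rw [← dvd_iff]
        rw [Nat.cast_sum]
        exact Finset.sum_le_sum fun i _ => card_filter_pow_dvd_le_emultiplicity _ _ _
    _ = _ := (Finset.emultiplicity_prod hπ _ _).symm

theorem IsDigitSystem.emultiplicity_prod_digitPoint_sub (H : IsDigitSystem q rep π)
    (hπ : Prime π) (j : ℕ) :
    emultiplicity π (∏ i ∈ Finset.range j, (digitPoint q rep π j - digitPoint q rep π i))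
      = (∑ k ∈ Finset.Icc 1 j, j / q ^ k : ℕ) := by
  have emultiplicity_sub (i : ℕ) (hi : i ∈ Finset.range j) :
      emultiplicity π (digitPoint q rep π j - digitPoint q rep π i)
        = {k ∈ Finset.Icc 1 j | i ≡ j [MOD q ^ k]}.card := by
    rw [Finset.mem_range] at hi
    have hdvd (k : ℕ) : q ^ k ∣ j - i ↔ i ≡ j [MOD q ^ k] := (Nat.modEq_iff_dvd' hi.le).symm
    have hlog : Nat.log q (j - i) < j + 1 :=
      Nat.lt_succ_of_le ((Nat.log_le_self q _).trans (Nat.sub_le j i))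
    have heq : emultiplicity π (digitPoint q rep π j - digitPoint q rep π i)
        = emultiplicity q (j - i) := emultiplicity_eq_emultiplicity_iff.mpr fun k => by
      rw [H.pow_dvd_digitPoint_sub_iff hπ.ne_zero, Nat.ModEq.comm, hdvd]
    rw [heq, Nat.emultiplicity_eq_card_pow_dvd (Nat.ne_of_gt H.two_le) (Nat.sub_pos_of_lt hi) hlog]
    simp_rw [hdvd]
    rfl
  rw [Finset.emultiplicity_prod hπ, Finset.sum_congr rfl emultiplicity_sub, ← Nat.cast_sum,
    sum_card_filter_modEq (Nat.zero_lt_of_lt H.two_le)]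
  simp only [lt_self_iff_false, if_false, add_zero]

end Ordering

/-! ### Lattices of polynomials with divisible values, and the resultant -/

section Determinant

variable {R ι M N : Type*} [CommRing R] [Fintype ι] [DecidableEq ι] [AddCommGroup M] [Module R M]
  [AddCommGroup N] [Module R N]

theorem det_dvd_det_of_mem_span (b : Module.Basis ι R N) {u v : ι → N}
    (h : ∀ k, u k ∈ Submodule.span R (Set.range v)) : b.det v ∣ b.det u := by
  choose c hc using fun k => (Submodule.mem_span_range_iff_exists_fun R).mp (h k)
  have hmul : b.toMatrix u = b.toMatrix v * Matrix.of fun j k => c k j := by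
    ext i k
    rw [Module.Basis.toMatrix_apply, ← hc k, map_sum, Finset.sum_apply', Matrix.mul_apply]
    refine Finset.sum_congr rfl fun j _ => ?_
    rw [map_smul, Finsupp.smul_apply, smul_eq_mul, mul_comm]
    rfl
  rw [Module.Basis.det_apply, Module.Basis.det_apply, hmul, Matrix.det_mul]
  exact dvd_mul_right _ _

theorem det_linearMap_comp (b : Module.Basis ι R M) (b' : Module.Basis ι R N) (Φ : M →ₗ[R] N)
    (w : ι → M) : b'.det (Φ ∘ w) = (LinearMap.toMatrix b b' Φ).det * b.det w := by
  rw [Module.Basis.det_apply, Module.Basis.det_apply, ← Matrix.det_mul]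
  congr 1
  ext i k
  exact (congrFun (LinearMap.toMatrix_mulVec_repr b b' Φ (w k)) i).symm

theorem det_basis_prod {κ : Type*} [Fintype κ] [DecidableEq κ] (b : Module.Basis ι R M)
    (b' : Module.Basis κ R N) (v : ι → M) (v' : κ → N) :
    (b.prod b').det (Sum.elim (LinearMap.inl R M N ∘ v) (LinearMap.inr R M N ∘ v'))
      = b.det v * b'.det v' := by
  have hblocks : (b.prod b').toMatrix
      (Sum.elim (LinearMap.inl R M N ∘ v) (LinearMap.inr R M N ∘ v'))
        = Matrix.fromBlocks (b.toMatrix v) 0 0 (b'.toMatrix v') := by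
    ext (i | i) (j | j) <;> simp [Module.Basis.toMatrix_apply]
  simp only [Module.Basis.det_apply, hblocks, Matrix.det_fromBlocks_zero₂₁]

end Determinant

section Lattice

open Polynomial

variable {R : Type*} [CommRing R]

/-- The Newton polynomial `∏_{i < j} (X - x_i)`. -/
noncomputable def newtonPoly (x : ℕ → R) (j : ℕ) : R[X] := ∏ i ∈ Finset.range j, (X - C (x i))

theorem newtonPoly_monic (x : ℕ → R) (j : ℕ) : (newtonPoly x j).Monic :=
  monic_prod_of_monic _ _ fun i _ => monic_X_sub_C (x i)

theorem degree_newtonPoly [Nontrivial R] (x : ℕ → R) (j : ℕ) : (newtonPoly x j).degree = j := by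
  rw [degree_eq_natDegree (newtonPoly_monic x j).ne_zero, newtonPoly,
    natDegree_prod_of_monic _ _ fun i _ => monic_X_sub_C (x i)]
  simp only [natDegree_X_sub_C, Finset.sum_const, Finset.card_range, smul_eq_mul, mul_one]

theorem eval_newtonPoly (x : ℕ → R) (j : ℕ) (y : R) :
    (newtonPoly x j).eval y = ∏ i ∈ Finset.range j, (y - x i) := by
  simp only [newtonPoly, eval_prod, eval_sub, eval_X, eval_C]

theorem eval_newtonPoly_eq_zero (x : ℕ → R) {i j : ℕ} (h : i < j) :
    (newtonPoly x j).eval (x i) = 0 := by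
  rw [eval_newtonPoly]
  exact Finset.prod_eq_zero (Finset.mem_range.mpr h) (sub_self _)

section Nontrivial

variable [Nontrivial R]

/-- The first `d` Newton polynomials, as elements of the module of polynomials of degree `< d`. -/
noncomputable def newtonFamily (x : ℕ → R) (d : ℕ) (j : Fin d) : degreeLT R d :=
  ⟨newtonPoly x j, mem_degreeLT.mpr ((degree_newtonPoly x j).trans_lt (Nat.cast_lt.mpr j.isLt))⟩

theorem det_newtonFamily (x : ℕ → R) (d : ℕ) :
    (degreeLT.basis R d).det (newtonFamily x d) = 1 := by
  rw [Module.Basis.det_apply, Matrix.det_of_isUpperTriangular]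
  · refine Finset.prod_eq_one fun i _ => ?_
    have := (newtonPoly_monic x i).coeff_natDegree
    rwa [natDegree_eq_of_degree_eq_some (degree_newtonPoly x i)] at this
  · intro i j hij
    exact coeff_eq_zero_of_degree_lt
      ((degree_newtonPoly x j).trans_lt (Nat.cast_lt.mpr (Fin.lt_def.mp hij)))

theorem span_newtonFamily (x : ℕ → R) (d : ℕ) :
    Submodule.span R (Set.range (newtonFamily x d)) = ⊤ :=
  ((degreeLT.basis R d).is_basis_iff_det.mpr (det_newtonFamily x d ▸ isUnit_one)).2

/-- The Newton polynomials scaled by `π ^ b j`: for suitable `b` they span the lattice of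
polynomials whose values are divisible by given powers of `π`. -/
noncomputable def adaptedFamily (π : R) (x : ℕ → R) (b : ℕ → ℕ) (d : ℕ) (j : Fin d) :
    degreeLT R d :=
  π ^ b j • newtonFamily x d j

theorem det_adaptedFamily (π : R) (x : ℕ → R) (b : ℕ → ℕ) (d : ℕ) :
    (degreeLT.basis R d).det (adaptedFamily π x b d) = π ^ ∑ j ∈ Finset.range d, b j := by
  unfold adaptedFamily
  rw [AlternatingMap.map_smul_univ, det_newtonFamily, smul_eq_mul, mul_one,
    Finset.prod_pow_eq_pow_sum, Fin.sum_univ_eq_sum_range]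

/-- A Bhargava `π`-ordering `x_0, x_1, …` of `D`, with its `π`-sequence `a`: the values on `D` of
the `j`-th Newton polynomial are divisible by `π ^ a j`, and exactly so at `x_j`. -/
structure IsPiOrdering (π : R) (D : Set R) (x : ℕ → R) (a : ℕ → ℕ) : Prop where
  mem : ∀ j, x j ∈ D
  le_emultiplicity : ∀ j, ∀ y ∈ D, (a j : ℕ∞) ≤ emultiplicity π ((newtonPoly x j).eval y)
  emultiplicity_eq : ∀ j, emultiplicity π ((newtonPoly x j).eval (x j)) = a j

variable {π : R} {D : Set R} {x : ℕ → R} {a : ℕ → ℕ}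

theorem IsPiOrdering.pow_dvd_eval_adaptedFamily (H : IsPiOrdering π D x a) (u : ℕ) {d : ℕ}
    (j : Fin d) {y : R} (hy : y ∈ D) :
    π ^ u ∣ (adaptedFamily π x (fun j => u - a j) d j : R[X]).eval y := by
  rw [adaptedFamily, Submodule.coe_smul, eval_smul, smul_eq_mul]
  exact (pow_dvd_pow π (by omega)).trans <| pow_add π (u - a j) (a j) ▸
    mul_dvd_mul_left _ (pow_dvd_of_le_emultiplicity (H.le_emultiplicity j y hy))

end Nontrivial

variable [IsDomain R] {π : R} {D : Set R} {x : ℕ → R} {a : ℕ → ℕ}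

theorem IsPiOrdering.pow_dvd_coeff (H : IsPiOrdering π D x a) (hπ : Prime π) {u d : ℕ}
    {e : Fin d → R}
    (hu : ∀ y ∈ D, π ^ u ∣ ((∑ j, e j • newtonFamily x d j : degreeLT R d) : R[X]).eval y)
    (j : Fin d) : π ^ (u - a j) ∣ e j := by
  induction j using WellFoundedLT.induction with
  | ind j ih =>
    have other_terms (i : Fin d) (hi : i ≠ j) :
        π ^ u ∣ e i * (newtonPoly x i).eval (x j) := by
      rcases hi.lt_or_gt with hij | hji
      · have := mul_dvd_mul (ih i hij) (pow_dvd_of_le_emultiplicity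
          (H.le_emultiplicity i _ (H.mem j)))
        exact (pow_dvd_pow π (by omega)).trans (pow_add π (u - a i) (a i) ▸ this)
      · rw [eval_newtonPoly_eq_zero x hji, mul_zero]
        exact dvd_zero _
    have diagonal_term : π ^ u ∣ e j * (newtonPoly x j).eval (x j) := by
      have hsum := hu _ (H.mem j)
      rw [Submodule.coe_sum, eval_finsetSum, ← Finset.add_sum_erase _ _ (Finset.mem_univ j)] at hsum
      simp only [Submodule.coe_smul, eval_smul, smul_eq_mul] at hsum
      exact (dvd_add_left (Finset.dvd_sum fun i hi =>
        other_terms i (Finset.ne_of_mem_erase hi))).mp hsum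
    rw [pow_dvd_iff_le_emultiplicity, emultiplicity_mul hπ, H.emultiplicity_eq] at diagonal_term
    rw [pow_dvd_iff_le_emultiplicity, ENat.natCast_sub]
    exact tsub_le_iff_right.mpr diagonal_term

/-- The exponents of a basis of Newton polynomials for the lattice of polynomials whose values on
`D` are divisible by `π ^ u`, and by `π ^ S` at `x_0`. -/
def latticeExp (a : ℕ → ℕ) (S u j : ℕ) : ℕ := if j = 0 then S else u - a j

theorem sum_range_latticeExp {a b : ℕ → ℕ} (gc : GaloisConnection b a) (ha : a 0 = 0)
    (S u : ℕ) {d : ℕ} (hd : u ≤ a (d + 1)) :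
    u + ∑ j ∈ Finset.range (d + 1), latticeExp a S u j = S + ∑ m ∈ Finset.Icc 1 u, b m := by
  rw [← sum_range_tsub_eq_of_le gc hd, Finset.sum_range_succ', Finset.sum_range_succ', ha]
  simp only [latticeExp, Nat.add_eq_zero_iff, one_ne_zero, and_false, if_false, if_true, tsub_zero]
  omega

theorem IsPiOrdering.mem_span_adaptedFamily (H : IsPiOrdering π D x a) (hπ : Prime π)
    {S u d : ℕ} {g : degreeLT R d} (hu : ∀ y ∈ D, π ^ u ∣ (g : R[X]).eval y)
    (hS : π ^ S ∣ (g : R[X]).eval (x 0)) :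
    g ∈ Submodule.span R (Set.range (adaptedFamily π x (latticeExp a S u) d)) := by
  obtain ⟨e, rfl⟩ := (Submodule.mem_span_range_iff_exists_fun R).mp
    (span_newtonFamily x d ▸ Submodule.mem_top : g ∈ Submodule.span R _)
  have constant_term (j : Fin d) (hj : (j : ℕ) = 0) : π ^ S ∣ e j := by
    rw [Submodule.coe_sum, eval_finsetSum, Finset.sum_eq_single j] at hS
    · simpa only [Submodule.coe_smul, eval_smul, newtonFamily, hj, eval_newtonPoly,
        Finset.range_zero, Finset.prod_empty, smul_eq_mul, mul_one] using hS
    · intro i _ hi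
      rw [Submodule.coe_smul, eval_smul, newtonFamily, eval_newtonPoly_eq_zero x, smul_zero]
      exact Nat.pos_of_ne_zero fun h => hi (Fin.ext (h.trans hj.symm))
    · exact fun h => absurd (Finset.mem_univ j) h
  refine Submodule.sum_mem _ fun j _ => ?_
  have hdvd : π ^ latticeExp a S u j ∣ e j := by
    unfold latticeExp
    split_ifs with hj
    · exact constant_term j hj
    · exact H.pow_dvd_coeff hπ hu j
  obtain ⟨c, hc⟩ := hdvd
  rw [hc, mul_comm, mul_smul]
  exact Submodule.smul_mem _ _ (Submodule.subset_span (Set.mem_range_self j))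

theorem IsPiOrdering.pow_dvd_resultant_mul (H : IsPiOrdering π D x a) (hπ : Prime π)
    {f g : R[X]} {m n : ℕ} (hf : f.natDegree ≤ m) (hg : g.natDegree ≤ n) {S s : ℕ}
    (hfs : ∀ y ∈ D, π ^ s ∣ f.eval y) (hgs : ∀ y ∈ D, π ^ s ∣ g.eval y)
    (hfS : π ^ S ∣ f.eval (x 0)) (hgS : π ^ S ∣ g.eval (x 0)) (t : ℕ) :
    π ^ (∑ j ∈ Finset.range (m + n), latticeExp a (S + t) (s + t) j) ∣
      resultant f g m n *
        (π ^ (∑ j ∈ Finset.range m, (t - a j)) * π ^ (∑ j ∈ Finset.range n, (t - a j))) := by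
  let B := (degreeLT.basis R m).prod (degreeLT.basis R n)
  let Φ := sylvesterMap f g hf hg
  let w : Fin m ⊕ Fin n → degreeLT R m × degreeLT R n := Sum.elim
    (LinearMap.inl R _ _ ∘ adaptedFamily π x (fun j => t - a j) m)
    (LinearMap.inr R _ _ ∘ adaptedFamily π x (fun j => t - a j) n)
  have hdet : (degreeLT.basis R (m + n)).det (Φ ∘ (w ∘ finSumFinEquiv.symm)) = resultant f g m n *
      (π ^ (∑ j ∈ Finset.range m, (t - a j)) * π ^ (∑ j ∈ Finset.range n, (t - a j))) := by
    rw [det_linearMap_comp (B.reindex finSumFinEquiv), toMatrix_sylvesterMap',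
      Module.Basis.det_reindex, Function.comp_assoc, Equiv.symm_comp_self, Function.comp_id,
      det_basis_prod, det_adaptedFamily, det_adaptedFamily, resultant]
  have hΦ (k : Fin (m + n)) : ∀ y ∈ D, ∀ r, π ^ r ∣ f.eval y → π ^ r ∣ g.eval y →
      π ^ (r + t) ∣ (Φ (w (finSumFinEquiv.symm k)) : R[X]).eval y := by
    intro y hy r hfr hgr
    rw [sylvesterMap_apply_coe, pow_add]
    rcases finSumFinEquiv.symm k with j | j
    · simpa [w] using mul_dvd_mul hgr (H.pow_dvd_eval_adaptedFamily t j hy)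
    · simpa [w] using mul_dvd_mul hfr (H.pow_dvd_eval_adaptedFamily t j hy)
  rw [← hdet, ← det_adaptedFamily]
  exact det_dvd_det_of_mem_span _ fun k => H.mem_span_adaptedFamily hπ
    (fun y hy => hΦ k y hy s (hfs y hy) (hgs y hy)) (hΦ k _ (H.mem 0) S hfS hgS)

theorem IsDigitSystem.isPiOrdering {q : ℕ} {rep : ℕ → R} (H : IsDigitSystem q rep π)
    (hπ : Prime π) (ε : ℕ) {x₀ : R} (hx₀ : π ^ ε ∣ x₀) :
    IsPiOrdering π {y | π ^ ε ∣ y} (fun j => x₀ + π ^ ε * digitPoint q rep π j)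
      (fun j => ε * j + ∑ k ∈ Finset.Icc 1 j, j / q ^ k) := by
  have emultiplicity_eval (z : R) (j : ℕ) : emultiplicity π
      ((newtonPoly (fun j => x₀ + π ^ ε * digitPoint q rep π j) j).eval (x₀ + π ^ ε * z))
        = (ε * j : ℕ) + emultiplicity π (∏ i ∈ Finset.range j, (z - digitPoint q rep π i)) := by
    simp only [eval_newtonPoly, add_sub_add_left_eq_sub, ← mul_sub, Finset.prod_mul_distrib,
      Finset.prod_const, Finset.card_range, ← pow_mul, emultiplicity_mul hπ,
      emultiplicity_pow_self hπ.ne_zero hπ.not_isUnit]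
  refine ⟨fun j => dvd_add hx₀ (dvd_mul_right _ _), fun j y hy => ?_, fun j => ?_⟩
  · obtain ⟨z, hz⟩ := dvd_sub hy hx₀
    rw [eq_add_of_sub_eq' hz, emultiplicity_eval, Nat.cast_add]
    gcongr
    exact H.le_emultiplicity_prod_sub hπ z j
  · rw [emultiplicity_eval, H.emultiplicity_prod_digitPoint_sub hπ, Nat.cast_add]

theorem pow_dvd_resultant_mul_of_finite_quotient [Finite (R ⧸ Ideal.span {π})] (hπ : Prime π)
    {ε : ℕ} {a b : ℕ → ℕ} (gc : GaloisConnection b a)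
    (ha : ∀ j, a j = ε * j + ∑ k ∈ Finset.Icc 1 j, j / Nat.card (R ⧸ Ideal.span {π}) ^ k)
    {f g : R[X]} (hf : f.Monic) {S s : ℕ} {x₀ : R} (hx₀ : π ^ ε ∣ x₀)
    (hfs : ∀ y, π ^ ε ∣ y → π ^ s ∣ f.eval y) (hgs : ∀ y, π ^ ε ∣ y → π ^ s ∣ g.eval y)
    (hfS : π ^ S ∣ f.eval x₀) (hgS : π ^ S ∣ g.eval x₀) (t : ℕ) :
    π ^ (S + ∑ m ∈ Finset.Icc 1 (s + t), b m) ∣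
      resultant f g * π ^ (2 * (∑ m ∈ Finset.Icc 1 t, b m) + s) := by
  have : Nontrivial (R ⧸ Ideal.span {π}) := Ideal.Quotient.nontrivial_iff.mpr
    (Ideal.span_singleton_ne_top hπ.not_isUnit)
  obtain ⟨rep, H⟩ := exists_isDigitSystem π
  have hord := H.isPiOrdering hπ ε hx₀
  have hx0 : x₀ + π ^ ε * digitPoint (Nat.card (R ⧸ Ideal.span {π})) rep π 0 = x₀ := by
    rw [digitPoint_zero, mul_zero, add_zero]
  rw [← (funext ha : a = _)] at hord
  -- As `f` is monic, raising the formal degree of `g` to `n` does not change the resultant; it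
  -- makes the lattice large enough for the truncated sum of exponents to reach its full value.
  obtain ⟨n, hn⟩ : ∃ n, n = g.natDegree + (b (s + t) + 1) := ⟨_, rfl⟩
  have hdet := hord.pow_dvd_resultant_mul hπ le_rfl (by omega : g.natDegree ≤ n)
    hfs hgs (hx0.symm ▸ hfS) (hx0.symm ▸ hgS) t
  have hres : resultant f g f.natDegree n = resultant f g := by
    rw [hn, resultant_add_right_deg _ _ _ _ _ le_rfl, coeff_natDegree, hf.leadingCoeff, one_pow,
      one_mul]
  rw [hres, ← pow_add] at hdet
  have hexp := sum_range_latticeExp gc (by rw [ha]; rfl) (S + t) (s + t)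
    (d := f.natDegree + g.natDegree + b (s + t)) ((gc _ _).mp (by omega))
  rw [show f.natDegree + g.natDegree + b (s + t) + 1 = f.natDegree + n by omega] at hexp
  have hsum_f := sum_range_tsub_le gc t f.natDegree
  have hsum_g := sum_range_tsub_le gc t n
  rw [show S + ∑ m ∈ Finset.Icc 1 (s + t), b m
    = ∑ j ∈ Finset.range (f.natDegree + n), latticeExp a (S + t) (s + t) j + s by omega, pow_add,
    pow_add _ _ s, ← mul_assoc]
  exact mul_dvd_mul_right (hdet.trans (mul_dvd_mul_left _ (pow_dvd_pow _ (by omega)))) _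

end Lattice

/-! ### The ring of integers of a finite extension of `ℚ_p` -/

section RingInt

open Filter

variable {p : ℕ} [Fact p.Prime]

theorem norm_natCast_prime : ‖(p : ℂ_[p])‖ = (p : ℝ)⁻¹ := by
  rw [← map_natCast (algebraMap ℚ_[p] ℂ_[p]) p, ← Padic.norm_p]
  exact PadicComplex.norm_extends' p (p : ℚ_[p])

theorem norm_natCast_prime_lt_one : ‖(p : ℂ_[p])‖ < 1 := by
  rw [norm_natCast_prime]
  exact inv_lt_one_of_one_lt₀ (by exact_mod_cast (Fact.out : p.Prime).one_lt)

theorem natCast_prime_ne_zero : (p : ℂ_[p]) ≠ 0 := by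
  exact_mod_cast (Fact.out : p.Prime).ne_zero

theorem mem_padicComplexInt_iff_norm_le_one (x : ℂ_[p]) : x ∈ PadicComplexInt p ↔ ‖x‖ ≤ 1 := by
  rw [PadicComplexInt, Valuation.mem_valuationSubring_iff, PadicComplex.norm_eq_norm]
  exact Valued.toNormedField.norm_le_one_iff.symm

variable {K : IntermediateField ℚ_[p] ℂ_[p]}

theorem mem_ringInt_iff_norm_le_one (x : K) : x ∈ ringInt K ↔ ‖(x : ℂ_[p])‖ ≤ 1 :=
  mem_padicComplexInt_iff_norm_le_one (x : ℂ_[p])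

theorem norm_incl_le_one (x : ringInt K) : ‖incl K x‖ ≤ 1 :=
  (mem_ringInt_iff_norm_le_one _).mp x.2

theorem incl_injective : Function.Injective (incl K) :=
  (algebraMap K ℂ_[p]).injective.comp Subtype.val_injective

theorem incl_eq_zero {x : ringInt K} : incl K x = 0 ↔ x = 0 :=
  map_eq_zero_iff _ incl_injective

theorem norm_incl_pos {x : ringInt K} (hx : x ≠ 0) : 0 < ‖incl K x‖ :=
  norm_pos_iff.mpr (incl_eq_zero.not.mpr hx)

theorem exists_incl_eq {z : ℂ_[p]} (hz : z ∈ K) (h : ‖z‖ ≤ 1) : ∃ x : ringInt K, incl K x = z :=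
  ⟨⟨⟨z, hz⟩, (mem_ringInt_iff_norm_le_one _).mpr h⟩, rfl⟩

theorem dvd_iff_norm_le {x y : ringInt K} : x ∣ y ↔ ‖incl K y‖ ≤ ‖incl K x‖ := by
  constructor
  · rintro ⟨c, rfl⟩
    rw [map_mul, norm_mul]
    exact mul_le_of_le_one_right (norm_nonneg _) (norm_incl_le_one c)
  · intro h
    rcases eq_or_ne x 0 with rfl | hx
    · rw [map_zero, norm_zero, norm_le_zero_iff, incl_eq_zero] at h
      rw [h]
    · obtain ⟨c, hc⟩ := exists_incl_eq (K := K) (z := incl K y / incl K x)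
        (K.div_mem (y : K).2 (x : K).2)
        (by rw [norm_div]; exact div_le_one_of_le₀ h (norm_nonneg _))
      refine ⟨c, incl_injective ?_⟩
      rw [map_mul, hc, mul_div_cancel₀ _ (incl_eq_zero.not.mpr hx)]

theorem pow_dvd_iff_norm_le {x y : ringInt K} {k : ℕ} :
    x ^ k ∣ y ↔ ‖incl K y‖ ≤ ‖incl K x‖ ^ k := by
  rw [dvd_iff_norm_le, map_pow, norm_pow]

theorem isUnit_iff_norm_eq_one {x : ringInt K} : IsUnit x ↔ ‖incl K x‖ = 1 := by
  rw [isUnit_iff_dvd_one, dvd_iff_norm_le, map_one, norm_one]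
  exact ⟨(norm_incl_le_one x).antisymm, Eq.ge⟩

theorem mem_maximalIdeal_iff_norm_lt_one {x : ringInt K} :
    x ∈ IsLocalRing.maximalIdeal (ringInt K) ↔ ‖incl K x‖ < 1 := by
  rw [IsLocalRing.mem_maximalIdeal, mem_nonunits_iff, isUnit_iff_norm_eq_one]
  exact ⟨(norm_incl_le_one x).lt_of_ne, ne_of_lt⟩

theorem image_incl_setOf_dvd (c : ringInt K) :
    incl K '' {y | c ∣ y} = {z | z ∈ K ∧ ‖z‖ ≤ ‖incl K c‖} := by
  ext z
  constructor
  · rintro ⟨y, hy, rfl⟩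
    exact ⟨(y : K).2, dvd_iff_norm_le.mp hy⟩
  · rintro ⟨hz, hle⟩
    obtain ⟨y, rfl⟩ := exists_incl_eq hz (hle.trans (norm_incl_le_one c))
    exact ⟨y, dvd_iff_norm_le.mpr hle, rfl⟩

theorem closedBall_inter_eq_image_incl :
    Metric.closedBall (0 : ℂ_[p]) 1 ∩ (K : Set ℂ_[p]) = incl K '' {y | 1 ∣ y} := by
  rw [image_incl_setOf_dvd, map_one, norm_one]
  ext z
  rw [Set.mem_inter_iff, mem_closedBall_zero_iff, and_comm]
  rfl

section FiniteDimensional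

variable [FiniteDimensional ℚ_[p] K]

theorem isCompact_image_incl_setOf_dvd (c : ringInt K) : IsCompact (incl K '' {y | c ∣ y}) := by
  have : ProperSpace K := FiniteDimensional.proper ℚ_[p] K
  convert (isCompact_closedBall (0 : K) ‖incl K c‖).image continuous_subtype_val using 1
  rw [image_incl_setOf_dvd]
  ext z
  simp only [Set.mem_ofPred_eq, Set.mem_image, mem_closedBall_zero_iff]
  exact ⟨fun h => ⟨⟨z, h.1⟩, h.2, rfl⟩, by rintro ⟨y, hy, rfl⟩; exact ⟨y.2, hy⟩⟩

theorem finite_residueField : Finite (IsLocalRing.ResidueField (ringInt K)) := by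
  obtain ⟨T, hTK, hT, hcover⟩ := Metric.finite_approx_of_totallyBounded
    (isCompact_image_incl_setOf_dvd (1 : ringInt K)).totallyBounded 1 one_pos
  refine Set.finite_univ_iff.mp
    (((hT.preimage incl_injective.injOn).image (IsLocalRing.residue _)).subset fun k _ => ?_)
  obtain ⟨x, rfl⟩ := IsLocalRing.residue_surjective k
  obtain ⟨z, hz, hxz⟩ := Set.mem_iUnion₂.mp (hcover ⟨x, one_dvd x, rfl⟩)
  obtain ⟨y, -, rfl⟩ := hTK hz
  refine ⟨y, hz, ?_⟩
  rwa [← sub_eq_zero, ← map_sub, IsLocalRing.residue_eq_zero_iff,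
    mem_maximalIdeal_iff_norm_lt_one, map_sub, ← dist_eq_norm, dist_comm]

theorem card_residueField :
    Nat.card (IsLocalRing.ResidueField (ringInt K)) = p ^ residueDeg K := by
  have := finite_residueField (K := K)
  have : CharP (IsLocalRing.ResidueField (ringInt K)) p := by
    refine (CharP.charP_iff_prime_eq_zero (Fact.out : p.Prime)).mpr ?_
    rw [← map_natCast (IsLocalRing.residue (ringInt K)), IsLocalRing.residue_eq_zero_iff,
      mem_maximalIdeal_iff_norm_lt_one, map_natCast]
    exact norm_natCast_prime_lt_one
  rw [Module.natCard_eq_pow_finrank (K := (⊥ : Subfield (IsLocalRing.ResidueField (ringInt K)))),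
    Subfield.card_bot _ p, residueDeg]

end FiniteDimensional

section Uniformizer

open IsLocalRing

variable {π : ringInt K}

theorem norm_lt_one_iff_dvd (hπ : maximalIdeal (ringInt K) = Ideal.span {π})
    {x : ringInt K} : ‖incl K x‖ < 1 ↔ π ∣ x := by
  rw [← mem_maximalIdeal_iff_norm_lt_one, hπ, Ideal.mem_span_singleton]

theorem norm_uniformizer_lt_one (hπ : maximalIdeal (ringInt K) = Ideal.span {π}) : ‖incl K π‖ < 1 :=
  (norm_lt_one_iff_dvd hπ).mpr dvd_rfl

theorem uniformizer_ne_zero (hπ : maximalIdeal (ringInt K) = Ideal.span {π}) : π ≠ 0 := by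
  rintro rfl
  have h : (0 : ringInt K) ∣ (p : ringInt K) := by
    rw [← norm_lt_one_iff_dvd hπ, map_natCast]
    exact norm_natCast_prime_lt_one
  rw [zero_dvd_iff, ← incl_eq_zero, map_natCast] at h
  exact natCast_prime_ne_zero h

theorem norm_uniformizer_pos (hπ : maximalIdeal (ringInt K) = Ideal.span {π}) : 0 < ‖incl K π‖ :=
  norm_incl_pos (uniformizer_ne_zero hπ)

theorem prime_uniformizer (hπ : maximalIdeal (ringInt K) = Ideal.span {π}) : Prime π :=
  (Ideal.span_singleton_prime (uniformizer_ne_zero hπ)).mp (hπ ▸ inferInstance)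

theorem ball_inter_eq_image_incl (hπ : maximalIdeal (ringInt K) = Ideal.span {π}) :
    Metric.ball (0 : ℂ_[p]) 1 ∩ (K : Set ℂ_[p]) = incl K '' {y | π ∣ y} := by
  ext z
  rw [Set.mem_inter_iff, mem_ball_zero_iff]
  constructor
  · rintro ⟨hlt, hz⟩
    obtain ⟨y, rfl⟩ := exists_incl_eq hz hlt.le
    exact ⟨y, (norm_lt_one_iff_dvd hπ).mp hlt, rfl⟩
  · rintro ⟨y, hy, rfl⟩
    exact ⟨(norm_lt_one_iff_dvd hπ).mpr hy, (y : K).2⟩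

theorem norm_incl_eq_pow_multiplicity (hπ : maximalIdeal (ringInt K) = Ideal.span {π})
    {x : ringInt K} (hx : x ≠ 0) :
    ‖incl K x‖ = ‖incl K π‖ ^ multiplicity π x := by
  have hfin : FiniteMultiplicity π x := by
    obtain ⟨n, hn⟩ := exists_pow_lt_of_lt_one (norm_incl_pos hx) (norm_uniformizer_lt_one hπ)
    refine ⟨n, fun h => hn.not_ge ((pow_dvd_iff_norm_le.mp h).trans ?_)⟩
    exact pow_le_pow_of_le_one (norm_nonneg _) (norm_incl_le_one π) n.le_succ
  obtain ⟨u, hu, hnd⟩ := hfin.exists_eq_pow_mul_and_not_dvd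
  rw [← norm_lt_one_iff_dvd hπ, not_lt] at hnd
  conv_lhs => rw [hu]
  rw [map_mul, norm_mul, (norm_incl_le_one u).antisymm hnd, mul_one, map_pow, norm_pow]

theorem norm_natCast_prime_eq_pow (hπ : maximalIdeal (ringInt K) = Ideal.span {π}) :
    ‖(p : ℂ_[p])‖ = ‖incl K π‖ ^ ramIndex π := by
  have hp : (p : ringInt K) ≠ 0 := by
    rw [Ne, ← incl_eq_zero, map_natCast]
    exact natCast_prime_ne_zero
  rw [ramIndex, ← norm_incl_eq_pow_multiplicity hπ hp, map_natCast]

theorem ramIndex_pos (hπ : maximalIdeal (ringInt K) = Ideal.span {π}) : 0 < ramIndex π := by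
  refine Nat.pos_of_ne_zero fun h => (norm_natCast_prime_lt_one (p := p)).ne ?_
  rw [norm_natCast_prime_eq_pow hπ, h, pow_zero]

theorem sModEq_maximalIdeal_pow_iff (hπ : maximalIdeal (ringInt K) = Ideal.span {π})
    {n : ℕ} {x y : ringInt K} :
    x ≡ y [SMOD (maximalIdeal (ringInt K) ^ n • ⊤ :
      Submodule (ringInt K) (ringInt K))] ↔ ‖incl K x - incl K y‖ ≤ ‖incl K π‖ ^ n := by
  rw [SModEq.sub_mem, smul_eq_mul, Ideal.mul_top, hπ, Ideal.span_singleton_pow,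
    Ideal.mem_span_singleton, pow_dvd_iff_norm_le, map_sub]

theorem isHausdorff_ringInt (hπ : maximalIdeal (ringInt K) = Ideal.span {π}) :
    IsHausdorff (maximalIdeal (ringInt K)) (ringInt K) where
  haus' x hx := by
    rw [← incl_eq_zero, ← norm_le_zero_iff]
    refine ge_of_tendsto' (tendsto_pow_atTop_nhds_zero_of_lt_one (norm_nonneg _)
      (norm_uniformizer_lt_one hπ)) fun n => ?_
    simpa only [map_zero, sub_zero] using (sModEq_maximalIdeal_pow_iff hπ).mp (hx n)

theorem isPrecomplete_ringInt (hπ : maximalIdeal (ringInt K) = Ideal.span {π})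
    [FiniteDimensional ℚ_[p] K] :
    IsPrecomplete (maximalIdeal (ringInt K)) (ringInt K) where
  prec' f hf := by
    have hdist {m n : ℕ} (hmn : m ≤ n) : ‖incl K (f m) - incl K (f n)‖ ≤ ‖incl K π‖ ^ m :=
      (sModEq_maximalIdeal_pow_iff hπ).mp (hf hmn)
    have hcauchy : CauchySeq fun n => ((f n : ringInt K) : K) := by
      refine Metric.cauchySeq_iff'.mpr fun δ hδ => ?_
      obtain ⟨N, hN⟩ := exists_pow_lt_of_lt_one hδ (norm_uniformizer_lt_one hπ)
      refine ⟨N, fun n hn => ?_⟩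
      rw [dist_comm, dist_eq_norm]
      exact (hdist hn).trans_lt hN
    have := FiniteDimensional.complete ℚ_[p] K
    obtain ⟨l, hl⟩ := cauchySeq_tendsto_of_complete hcauchy
    have hlim : Tendsto (fun n => incl K (f n)) atTop (nhds (l : ℂ_[p])) :=
      (continuous_subtype_val.tendsto l).comp hl
    have hl_le : ‖(l : ℂ_[p])‖ ≤ 1 := le_of_tendsto' hlim.norm fun n => norm_incl_le_one (f n)
    refine ⟨⟨l, (mem_ringInt_iff_norm_le_one l).mpr hl_le⟩, fun n => ?_⟩
    refine (sModEq_maximalIdeal_pow_iff hπ).mpr (le_of_tendsto (hlim.const_sub _).norm ?_)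
    filter_upwards [eventually_ge_atTop n] with k hk using hdist hk

theorem isAdicComplete_ringInt (hπ : maximalIdeal (ringInt K) = Ideal.span {π})
    [FiniteDimensional ℚ_[p] K] :
    IsAdicComplete (maximalIdeal (ringInt K)) (ringInt K) :=
  { isHausdorff_ringInt hπ, isPrecomplete_ringInt hπ with }

end Uniformizer

end RingInt

/-! ### Values and zeros of convergent power series -/

section Eval

open PowerSeries Filter

theorem hasSum_antidiagonal_mul {R : Type*} [NormedField R] [IsUltrametricDist R]
    {f g : ℕ → R} (hf : Summable f) (hg : Summable g) :
    HasSum (fun n => ∑ kl ∈ Finset.HasAntidiagonal.antidiagonal n, f kl.1 * g kl.2)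
      ((∑' i, f i) * ∑' i, g i) := by
  have : NonarchimedeanRing R :=
    { is_nonarchimedean := NonarchimedeanAddGroup.is_nonarchimedean }
  have h := Summable.mul_of_nonarchimedean hf hg
  rw [hf.tsum_mul_tsum_eq_tsum_sum_antidiagonal hg h]
  exact (summable_sum_mul_antidiagonal_of_summable_mul h).hasSum

theorem derivation_pow_succ_mul {R A : Type*} [CommRing R] [CommRing A] [Algebra R A]
    (D : Derivation R A A) {a : A} (ha : D a = 1) (k : ℕ) (b : A) :
    D (a ^ (k + 1) * b) = a ^ k * ((k + 1 : ℕ) * b + a * D b) := by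
  rw [D.leibniz, D.leibniz_pow, ha]
  simp only [Nat.add_sub_cancel, smul_eq_mul, nsmul_eq_mul, mul_one]
  ring

variable {p : ℕ} [Fact p.Prime]

/-- Convergence of `F` at the point `z`, the pointwise form of `ConvergesOn`. -/
def ConvergesAt (F : ℂ_[p]⟦X⟧) (z : ℂ_[p]) : Prop := Summable fun i : ℕ => coeff i F * z ^ i

variable {F G L U : ℂ_[p]⟦X⟧} {z : ℂ_[p]}

theorem convergesAt_iff_tendsto :
    ConvergesAt F z ↔ Tendsto (fun i : ℕ => coeff i F * z ^ i) atTop (nhds 0) := by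
  rw [ConvergesAt, NonarchimedeanAddGroup.summable_iff_tendsto_cofinite_zero,
    Nat.cofinite_eq_atTop]

theorem hasSum_mul (hF : ConvergesAt F z) (hG : ConvergesAt G z) :
    HasSum (fun i : ℕ => coeff i (F * G) * z ^ i) (evalAt F z * evalAt G z) := by
  have hterm (n : ℕ) : coeff n (F * G) * z ^ n = ∑ kl ∈ Finset.HasAntidiagonal.antidiagonal n,
      coeff kl.1 F * z ^ kl.1 * (coeff kl.2 G * z ^ kl.2) := by
    rw [coeff_mul, Finset.sum_mul]
    refine Finset.sum_congr rfl fun kl h => ?_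
    rw [← Finset.HasAntidiagonal.mem_antidiagonal.mp h, pow_add]
    ring
  rw [funext hterm]
  exact (hasSum_antidiagonal_mul hF hG :)

theorem ConvergesAt.mul (hF : ConvergesAt F z) (hG : ConvergesAt G z) : ConvergesAt (F * G) z :=
  (hasSum_mul hF hG).summable

theorem evalAt_mul (hF : ConvergesAt F z) (hG : ConvergesAt G z) :
    evalAt (F * G) z = evalAt F z * evalAt G z :=
  (hasSum_mul hF hG).tsum_eq

theorem ConvergesAt.add (hF : ConvergesAt F z) (hG : ConvergesAt G z) :
    ConvergesAt (F + G) z := by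
  unfold ConvergesAt
  simp_rw [map_add, add_mul]
  exact Summable.add hF hG

theorem evalAt_add (hF : ConvergesAt F z) (hG : ConvergesAt G z) :
    evalAt (F + G) z = evalAt F z + evalAt G z := by
  unfold evalAt
  simp_rw [map_add, add_mul]
  exact Summable.tsum_add hF hG

theorem hasSum_coe (P : Polynomial ℂ_[p]) (z : ℂ_[p]) :
    HasSum (fun i : ℕ => coeff i (P : ℂ_[p]⟦X⟧) * z ^ i) (P.eval z) := by
  rw [Polynomial.eval_eq_sum_range]
  simp_rw [Polynomial.coeff_coe]
  refine hasSum_sum_of_ne_finset_zero fun i hi => ?_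
  rw [Finset.mem_range, not_lt] at hi
  rw [Polynomial.coeff_eq_zero_of_natDegree_lt (by omega), zero_mul]

theorem convergesAt_coe (P : Polynomial ℂ_[p]) (z : ℂ_[p]) : ConvergesAt (P : ℂ_[p]⟦X⟧) z :=
  (hasSum_coe P z).summable

theorem evalAt_coe (P : Polynomial ℂ_[p]) (z : ℂ_[p]) : evalAt (P : ℂ_[p]⟦X⟧) z = P.eval z :=
  (hasSum_coe P z).tsum_eq

theorem ConvergesAt.derivative (hF : ConvergesAt F z) : ConvergesAt (derivative ℂ_[p] F) z := by
  rw [convergesAt_iff_tendsto] at *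
  rcases eq_or_ne z 0 with rfl | hz
  · refine tendsto_const_nhds.congr' ?_
    filter_upwards [eventually_ge_atTop 1] with i hi
    rw [zero_pow (by omega), mul_zero]
  · have hlim : Tendsto (fun i : ℕ => ‖coeff (i + 1) F * z ^ (i + 1)‖ * ‖z‖⁻¹) atTop (nhds 0) := by
      simpa only [norm_zero, zero_mul, Function.comp_def] using
        ((hF.comp (tendsto_add_atTop_nat 1)).norm).mul_const ‖z‖⁻¹
    refine squeeze_zero_norm (fun i => ?_) hlim
    have hnat : ‖(i : ℂ_[p]) + 1‖ ≤ 1 := by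
      exact_mod_cast IsUltrametricDist.norm_natCast_le_one ℂ_[p] (i + 1)
    calc ‖coeff i (PowerSeries.derivative ℂ_[p] F) * z ^ i‖
        = ‖coeff (i + 1) F‖ * ‖(i : ℂ_[p]) + 1‖ * ‖z‖ ^ i := by
          rw [coeff_derivative, norm_mul, norm_mul, norm_pow]
      _ ≤ ‖coeff (i + 1) F‖ * 1 * ‖z‖ ^ i := by gcongr
      _ = ‖coeff (i + 1) F * z ^ (i + 1)‖ * ‖z‖⁻¹ := by
          have := norm_ne_zero_iff.mpr hz
          rw [norm_mul, norm_pow]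
          field_simp
          ring

theorem ConvergesAt.pow_mul (hL : ConvergesAt L z) (hU : ConvergesAt U z) (k : ℕ) :
    ConvergesAt (L ^ k * U) z := by
  induction k with
  | zero => rwa [pow_zero, one_mul]
  | succ k ih => rw [pow_succ', mul_assoc]; exact hL.mul ih

theorem evalAt_iterate_derivative_pow_mul_ne_zero_iff (hL : ConvergesAt L z)
    (hL0 : evalAt L z = 0) (hL1 : derivative ℂ_[p] L = 1) (hU : ConvergesAt U z)
    (hU0 : evalAt U z ≠ 0) {j k : ℕ} (hj : j ≤ k) :
    evalAt ((derivative ℂ_[p])^[j] (L ^ k * U)) z ≠ 0 ↔ j = k := by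
  induction k generalizing j U with
  | zero => simpa only [Nat.le_zero.mp hj, Function.iterate_zero, id, pow_zero, one_mul, iff_true]
  | succ k ih =>
    rcases j with _ | j
    · rw [Function.iterate_zero, id, pow_succ', mul_assoc, evalAt_mul hL (hL.pow_mul hU k), hL0,
        zero_mul]
      simp only [ne_eq, not_true_eq_false, false_iff]
      omega
    have hnat : (((k + 1 : ℕ) : Polynomial ℂ_[p]) : ℂ_[p]⟦X⟧) = ((k + 1 : ℕ) : ℂ_[p]⟦X⟧) :=
      map_natCast (Polynomial.coeToPowerSeries.ringHom) (k + 1)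
    have hc := convergesAt_coe ((k + 1 : ℕ) : Polynomial ℂ_[p]) z
    have hLU' := hL.mul hU.derivative
    rw [Function.iterate_succ_apply, derivation_pow_succ_mul _ hL1, ← hnat,
      ih ((hc.mul hU).add hLU') ?_ (Nat.le_of_succ_le_succ hj), Nat.succ_inj]
    rw [evalAt_add (hc.mul hU) hLU', evalAt_mul hL hU.derivative, hL0, zero_mul, add_zero,
      evalAt_mul hc hU, evalAt_coe, Polynomial.eval_natCast]
    exact mul_ne_zero (Nat.cast_ne_zero.mpr k.succ_ne_zero) hU0

theorem zeroMult_pow_mul (hL : ConvergesAt L z) (hL0 : evalAt L z = 0)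
    (hL1 : derivative ℂ_[p] L = 1) (hU : ConvergesAt U z) (hU0 : evalAt U z ≠ 0) (k : ℕ) :
    zeroMult (L ^ k * U) z = k := by
  have hiff {j : ℕ} (hj : j ≤ k) :=
    evalAt_iterate_derivative_pow_mul_ne_zero_iff hL hL0 hL1 hU hU0 hj
  have hk := (hiff le_rfl).mpr rfl
  have hmem := Nat.sInf_mem
    (s := {j | evalAt ((derivative ℂ_[p])^[j] (L ^ k * U)) z ≠ 0}) ⟨k, hk⟩
  exact (hiff (Nat.sInf_le hk)).mp hmem

theorem zeroMult_coe_mul {P : Polynomial ℂ_[p]} (hP : P ≠ 0) (hU : ConvergesAt U z)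
    (hU0 : evalAt U z ≠ 0) : zeroMult ((P : ℂ_[p]⟦X⟧) * U) z = P.rootMultiplicity z := by
  set k := P.rootMultiplicity z
  set W := P /ₘ (Polynomial.X - Polynomial.C z) ^ k
  have hfactor : (Polynomial.X - Polynomial.C z) ^ k * W = P :=
    P.pow_mul_divByMonic_rootMultiplicity_eq z
  have hW : W.eval z ≠ 0 := Polynomial.eval_divByMonic_pow_rootMultiplicity_ne_zero z hP
  rw [← hfactor, Polynomial.coe_mul, Polynomial.coe_pow, mul_assoc]
  refine zeroMult_pow_mul (convergesAt_coe _ z) ?_ ?_ ((convergesAt_coe W z).mul hU) ?_ k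
  · rw [evalAt_coe, Polynomial.eval_sub, Polynomial.eval_X, Polynomial.eval_C, sub_self]
  · rw [derivative_coe, Polynomial.derivative_X_sub_C, Polynomial.coe_one]
  · rw [evalAt_mul (convergesAt_coe W z) hU, evalAt_coe]
    exact mul_ne_zero hW hU0

theorem prodOverZeros_coe_mul {D : Set ℂ_[p]} {P : Polynomial ℂ_[p]} (hP : P ≠ 0)
    (hU : ConvergesOn U D) (hU0 : ∀ z ∈ D, evalAt U z ≠ 0) (hD : ∀ z ∈ P.roots, z ∈ D)
    (G : ℂ_[p]⟦X⟧) :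
    prodOverZeros D ((P : ℂ_[p]⟦X⟧) * U) G = (P.roots.map (evalAt G)).prod := by
  classical
  have hzeros : {z | z ∈ D ∧ evalAt ((P : ℂ_[p]⟦X⟧) * U) z = 0} = ↑P.roots.toFinset := by
    ext z
    rw [Finset.mem_coe, Multiset.mem_toFinset, Set.mem_ofPred_eq,
      ← and_iff_right_of_imp (hD z), and_congr_right_iff]
    intro hz
    rw [evalAt_mul (convergesAt_coe P z) (hU z hz), evalAt_coe, mul_eq_zero,
      or_iff_left (hU0 z hz), Polynomial.mem_roots hP, Polynomial.IsRoot.def]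
  rw [prodOverZeros, hzeros, finprod_mem_coe_finset, Finset.prod_multiset_map_count]
  refine Finset.prod_congr rfl fun z hz => ?_
  have hzD := hD z (Multiset.mem_toFinset.mp hz)
  rw [zeroMult_coe_mul hP (hU z hzD) (hU0 z hzD), Polynomial.count_roots]

theorem norm_evalAt_eq_norm_coeff_zero (hU : ConvergesAt U z) {c : ℝ} (hc : c < ‖coeff 0 U‖)
    (h : ∀ i, ‖coeff (i + 1) U * z ^ (i + 1)‖ ≤ c) : ‖evalAt U z‖ = ‖coeff 0 U‖ := by
  have hsplit : evalAt U z = coeff 0 U * z ^ 0 + ∑' i : ℕ, coeff (i + 1) U * z ^ (i + 1) :=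
    hU.tsum_eq_zero_add
  have htail : ‖∑' i : ℕ, coeff (i + 1) U * z ^ (i + 1)‖ < ‖coeff 0 U‖ :=
    (IsUltrametricDist.norm_tsum_le_of_forall_le_of_nonneg
      ((norm_nonneg _).trans (h 0)) h).trans_lt hc
  rw [hsplit, pow_zero, mul_one, IsUltrametricDist.norm_add_eq_max_of_norm_ne_norm htail.ne',
    max_eq_left htail.le]

end Eval

/-! ### Weierstrass preparation for restricted power series -/

section Restricted

open PowerSeries

variable {R : Type*} [CommRing R] {π : R}

theorem exists_seq_of_forall_exists_succ {α : Type*} {P : ℕ → α → Prop} {r : ℕ → α → α → Prop}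
    (h0 : ∃ x, P 0 x) (h : ∀ k x, P k x → ∃ y, P (k + 1) y ∧ r k x y) :
    ∃ x : ℕ → α, ∀ k, P k (x k) ∧ r k (x k) (x (k + 1)) := by
  obtain ⟨x₀, hx₀⟩ := h0
  choose! next hnext using h
  let x : ℕ → α := fun k => Nat.rec x₀ next k
  have hx (k : ℕ) : P k (x k) := by
    induction k with
    | zero => exact hx₀
    | succ k ih => exact (hnext k _ ih).1
  exact ⟨x, fun k => ⟨hx k, (hnext k _ (hx k)).2⟩⟩

theorem powerSeries_C_dvd_iff {a : R} {F : R⟦X⟧} : C a ∣ F ↔ ∀ i, a ∣ coeff i F := by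
  constructor
  · rintro ⟨G, rfl⟩ i
    rw [coeff_C_mul]
    exact Dvd.intro _ rfl
  · intro h
    choose g hg using h
    exact ⟨mk g, by ext i; rw [coeff_C_mul, coeff_mk, hg]⟩

theorem powerSeries_C_dvd_coe_iff {a : R} {P : Polynomial R} :
    C a ∣ (P : R⟦X⟧) ↔ Polynomial.C a ∣ P := by
  simp_rw [powerSeries_C_dvd_iff, Polynomial.C_dvd_iff_dvd_coeff, Polynomial.coeff_coe]

/-- `F` is a restricted power series for the `π`-adic topology: its coefficients tend to zero. -/
def IsRestrictedAt (π : R) (F : R⟦X⟧) : Prop := ∀ k, ∃ d, ∀ i, d ≤ i → π ^ k ∣ coeff i F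

theorem isRestrictedAt_iff_exists_polynomial {F : R⟦X⟧} :
    IsRestrictedAt π F ↔ ∀ k, ∃ T : Polynomial R, C (π ^ k) ∣ F - (T : R⟦X⟧) := by
  simp_rw [powerSeries_C_dvd_iff, map_sub, Polynomial.coeff_coe]
  refine forall_congr' fun k => ⟨fun ⟨d, hd⟩ => ⟨trunc d F, fun i => ?_⟩,
    fun ⟨T, hT⟩ => ⟨T.natDegree + 1, fun i hi => ?_⟩⟩
  · rw [coeff_trunc]
    split_ifs with hi
    · rw [sub_self]
      exact dvd_zero _
    · rw [sub_zero]
      exact hd i (not_lt.mp hi)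
  · rw [← sub_zero (coeff i F), ← Polynomial.coeff_eq_zero_of_natDegree_lt hi]
    exact hT i

theorem exists_hensel_lift [Nontrivial R] {T P U : Polynomial R} (hP : P.Monic) {u : R}
    (hu : IsUnit u) (hU : Polynomial.C π ∣ U - Polynomial.C u) {k : ℕ}
    (h : Polynomial.C (π ^ (k + 1)) ∣ T - P * U) :
    ∃ P' U' : Polynomial R, P'.Monic ∧ P'.natDegree = P.natDegree ∧
      Polynomial.C (π ^ (k + 1)) ∣ P' - P ∧ Polynomial.C (π ^ (k + 1)) ∣ U' - U ∧
      Polynomial.C (π ^ (k + 2)) ∣ T - P' * U' := by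
  obtain ⟨v, hv⟩ := hu.exists_left_inv
  obtain ⟨W, hW⟩ := hU
  obtain ⟨E, hE⟩ := h
  have hdiv := Polynomial.modByMonic_add_div E P
  set Q := E /ₘ P
  set r := E %ₘ P
  have hdeg : (Polynomial.C (π ^ (k + 1) * v) * r).degree < P.degree := by
    rw [← Polynomial.smul_eq_C_mul]
    exact (Polynomial.degree_smul_le _ _).trans_lt (Polynomial.degree_modByMonic_lt _ hP)
  refine ⟨P + Polynomial.C (π ^ (k + 1) * v) * r, U + Polynomial.C (π ^ (k + 1)) * Q,
    hP.add_of_left hdeg, Polynomial.natDegree_add_eq_left_of_degree_lt hdeg,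
    ⟨Polynomial.C v * r, ?_⟩, ⟨Q, by ring⟩,
    ⟨-Polynomial.C v * r * W - Polynomial.C (π ^ k * v) * r * Q, ?_⟩⟩
  · rw [map_mul]
    ring
  · have hCv := congrArg Polynomial.C hv
    simp only [map_mul, map_one, map_pow, pow_succ] at hE hCv ⊢
    linear_combination hE - Polynomial.C π ^ k * Polynomial.C π *
      (hdiv + Polynomial.C v * r * hW + r * hCv)

/-- `F = P U` modulo `π ^ (k + 1)` with `P` monic of degree `m` and `U` congruent to the constant
`u` modulo `π`; the pair `(P, U)` is encoded as `x`. -/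
structure IsApproxFactorization (π : R) (F : R⟦X⟧) (m : ℕ) (u : R) (k : ℕ)
    (x : Polynomial R × Polynomial R) : Prop where
  monic : x.1.Monic
  natDegree_eq : x.1.natDegree = m
  congr : Polynomial.C π ∣ x.2 - Polynomial.C u
  dvd : C (π ^ (k + 1)) ∣ F - (x.1 : R⟦X⟧) * (x.2 : R⟦X⟧)

theorem exists_isApproxFactorization_zero [Nontrivial R] {F : R⟦X⟧} {m : ℕ}
    (hm : IsUnit (coeff m F))
    (hgt : ∀ i, m < i → π ∣ coeff i F) :
    ∃ x, IsApproxFactorization π F m (coeff m F) 0 x := by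
  set u := coeff m F
  obtain ⟨v, hv⟩ := hm.exists_left_inv
  set P := Polynomial.C v * trunc (m + 1) F
  have hcoeff : P.coeff m = 1 := by
    rw [Polynomial.coeff_C_mul, coeff_trunc, if_pos m.lt_succ_self, hv]
  have hdeg : P.natDegree ≤ m :=
    (Polynomial.natDegree_C_mul_le _ _).trans (Nat.lt_succ_iff.mp (natDegree_trunc_lt F m))
  have hmul : P * Polynomial.C u = trunc (m + 1) F := by
    rw [mul_right_comm, ← Polynomial.C_mul, hv, Polynomial.C_1, one_mul]
  refine ⟨(P, Polynomial.C u), Polynomial.monic_of_natDegree_le_of_coeff_eq_one m hdeg hcoeff,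
    Polynomial.natDegree_eq_of_le_of_coeff_ne_zero hdeg (hcoeff ▸ one_ne_zero), ?_,
    powerSeries_C_dvd_iff.mpr fun i => ?_⟩
  · rw [sub_self]
    exact dvd_zero _
  · rw [← Polynomial.coe_mul, hmul, map_sub, Polynomial.coeff_coe, coeff_trunc, zero_add, pow_one]
    split_ifs with hi
    · rw [sub_self]
      exact dvd_zero _
    · rw [sub_zero]
      exact hgt i (by omega)

theorem IsApproxFactorization.exists_succ [Nontrivial R] {F : R⟦X⟧} (hF : IsRestrictedAt π F)
    {m : ℕ} {u : R} (hu : IsUnit u) {k : ℕ} {x : Polynomial R × Polynomial R}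
    (hx : IsApproxFactorization π F m u k x) :
    ∃ y, IsApproxFactorization π F m u (k + 1) y ∧
      Polynomial.C (π ^ (k + 1)) ∣ y.1 - x.1 ∧ Polynomial.C (π ^ (k + 1)) ∣ y.2 - x.2 := by
  obtain ⟨T, hT⟩ := isRestrictedAt_iff_exists_polynomial.mp hF (k + 2)
  have hle : C (π ^ (k + 1)) ∣ C (π ^ (k + 2)) := map_dvd C (pow_dvd_pow π (k + 1).le_succ)
  have hTx : Polynomial.C (π ^ (k + 1)) ∣ T - x.1 * x.2 := by
    rw [← powerSeries_C_dvd_coe_iff, Polynomial.coe_sub, Polynomial.coe_mul,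
      ← sub_sub_sub_cancel_left _ _ F]
    exact dvd_sub hx.dvd (hle.trans hT)
  obtain ⟨P, U, hP, hPdeg, hPx, hUx, hTPU⟩ := exists_hensel_lift hx.monic hu hx.congr hTx
  refine ⟨(P, U), ⟨hP, hPdeg.trans hx.natDegree_eq, ?_, ?_⟩, hPx, hUx⟩
  · rw [← sub_add_sub_cancel U x.2]
    exact dvd_add ((map_dvd Polynomial.C (dvd_pow_self π k.succ_ne_zero)).trans hUx) hx.congr
  · rw [← sub_add_sub_cancel F (T : R⟦X⟧), ← Polynomial.coe_mul, ← Polynomial.coe_sub]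
    exact dvd_add hT (powerSeries_C_dvd_coe_iff.mpr hTPU)

theorem sModEq_span_pow_iff {k : ℕ} {x y : R} :
    x ≡ y [SMOD (Ideal.span {π} ^ k • ⊤ : Submodule R R)] ↔ π ^ k ∣ x - y := by
  rw [SModEq.sub_mem, smul_eq_mul, Ideal.mul_top, Ideal.span_singleton_pow,
    Ideal.mem_span_singleton]

variable [IsAdicComplete (Ideal.span {π}) R]

theorem exists_pow_dvd_sub (f : ℕ → R) (hf : ∀ k, π ^ (k + 1) ∣ f (k + 1) - f k) :
    ∃ l, ∀ k, π ^ k ∣ l - f k := by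
  have hcauchy {m n : ℕ} (hmn : m ≤ n) : π ^ m ∣ f m - f n := by
    induction n, hmn using Nat.le_induction with
    | base =>
      rw [sub_self]
      exact dvd_zero _
    | succ n hn ih =>
      rw [← sub_sub_sub_cancel_right _ _ (f n)]
      exact dvd_sub ih ((pow_dvd_pow π (by omega)).trans (hf n))
  obtain ⟨l, hl⟩ := IsPrecomplete.prec (I := Ideal.span {π}) inferInstance (f := f)
    fun h => sModEq_span_pow_iff.mpr (hcauchy h)
  exact ⟨l, fun k => (dvd_sub_comm).mp (sModEq_span_pow_iff.mp (hl k))⟩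

theorem eq_of_forall_pow_dvd_sub {x y : R} (h : ∀ k, π ^ k ∣ x - y) : x = y :=
  sub_eq_zero.mp <| IsHausdorff.haus (I := Ideal.span {π}) inferInstance _ fun k => by
    rw [sModEq_span_pow_iff, sub_zero]
    exact h k

theorem exists_powerSeries_limit (f : ℕ → R⟦X⟧)
    (hf : ∀ k, C (π ^ (k + 1)) ∣ f (k + 1) - f k) : ∃ F : R⟦X⟧, ∀ k, C (π ^ k) ∣ F - f k := by
  simp_rw [powerSeries_C_dvd_iff, map_sub] at hf ⊢
  choose l hl using fun i => exists_pow_dvd_sub (fun k => coeff i (f k)) fun k => hf k i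
  exact ⟨mk l, fun k i => by rw [coeff_mk]; exact hl i k⟩

theorem exists_monic_limit {m : ℕ} (f : ℕ → Polynomial R) (hm : ∀ k, (f k).Monic)
    (hdeg : ∀ k, (f k).natDegree = m)
    (hf : ∀ k, Polynomial.C (π ^ (k + 1)) ∣ f (k + 1) - f k) :
    ∃ P : Polynomial R, P.Monic ∧ ∀ k, Polynomial.C (π ^ k) ∣ P - f k := by
  simp_rw [Polynomial.C_dvd_iff_dvd_coeff, Polynomial.coeff_sub] at hf ⊢
  choose l hl using fun i => exists_pow_dvd_sub (fun k => (f k).coeff i) fun k => hf k i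
  refine ⟨Polynomial.X ^ m + trunc m (mk l), Polynomial.monic_X_pow_add (degree_trunc_lt _ m),
    fun k i => ?_⟩
  rw [Polynomial.coeff_add, Polynomial.coeff_X_pow, coeff_trunc, coeff_mk]
  rcases lt_trichotomy i m with hi | rfl | hi
  · rw [if_neg hi.ne, if_pos hi, zero_add]
    exact hl i k
  · have := (hm k).coeff_natDegree
    rw [hdeg k] at this
    rw [if_pos rfl, if_neg (lt_irrefl _), this, add_zero, sub_self]
    exact dvd_zero _
  · rw [if_neg hi.ne', if_neg hi.not_gt, Polynomial.coeff_eq_zero_of_natDegree_lt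
      ((hdeg k).trans_lt hi), add_zero, sub_self]
    exact dvd_zero _

theorem exists_weierstrass_factorization_of_isRestrictedAt [Nontrivial R] {F : R⟦X⟧}
    (hF : IsRestrictedAt π F) {m : ℕ} (hm : IsUnit (coeff m F)) (hgt : ∀ i, m < i → π ∣ coeff i F) :
    ∃ (P : Polynomial R) (U : R⟦X⟧), P.Monic ∧ F = (P : R⟦X⟧) * U ∧ IsRestrictedAt π U ∧
      C π ∣ U - C (coeff m F) := by
  obtain ⟨x, hx⟩ := exists_seq_of_forall_exists_succ
    (exists_isApproxFactorization_zero hm hgt) fun _ _ h => h.exists_succ hF hm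
  obtain ⟨P, hP, hPlim⟩ := exists_monic_limit (fun k => (x k).1) (fun k => (hx k).1.monic)
    (fun k => (hx k).1.natDegree_eq) fun k => (hx k).2.1
  obtain ⟨U, hUlim⟩ := exists_powerSeries_limit (fun k => ((x k).2 : R⟦X⟧)) fun k => by
    rw [← Polynomial.coe_sub, powerSeries_C_dvd_coe_iff]
    exact (hx k).2.2
  refine ⟨P, U, hP, ?_, isRestrictedAt_iff_exists_polynomial.mpr fun k => ⟨_, hUlim k⟩, ?_⟩
  · have hdvd (k : ℕ) : C (π ^ k) ∣ F - (P : R⟦X⟧) * U := by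
      have hFx : C (π ^ k) ∣ F - ((x k).1 : R⟦X⟧) * ((x k).2 : R⟦X⟧) :=
        (map_dvd C (pow_dvd_pow π k.le_succ)).trans (hx k).1.dvd
      have hPx : C (π ^ k) ∣ (P : R⟦X⟧) - ((x k).1 : R⟦X⟧) := by
        rw [← Polynomial.coe_sub, powerSeries_C_dvd_coe_iff]
        exact hPlim k
      rw [show F - (P : R⟦X⟧) * U = F - ((x k).1 : R⟦X⟧) * ((x k).2 : R⟦X⟧)
        - ((P : R⟦X⟧) - ((x k).1 : R⟦X⟧)) * ((x k).2 : R⟦X⟧)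
        - (P : R⟦X⟧) * (U - ((x k).2 : R⟦X⟧)) by ring]
      exact dvd_sub (dvd_sub hFx (hPx.mul_right _)) ((hUlim k).mul_left _)
    ext i
    refine eq_of_forall_pow_dvd_sub (π := π) fun k => ?_
    rw [← map_sub]
    exact powerSeries_C_dvd_iff.mp (hdvd k) i
  · have h1 := hUlim 1
    rw [pow_one] at h1
    rw [← sub_add_sub_cancel U ((x 1).2 : R⟦X⟧), ← Polynomial.coe_C (coeff m F),
      ← Polynomial.coe_sub]
    exact dvd_add h1 (powerSeries_C_dvd_coe_iff.mpr (hx 1).1.congr)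

end Restricted

/-! ### Weierstrass preparation over the ring of integers -/

section RootBounds

variable {k : Type*} [NormedField k] [IsUltrametricDist k] {P : Polynomial k} {z : k}

theorem exists_norm_pow_natDegree_le_of_isRoot (hP : P.Monic) (hz : P.IsRoot z) :
    ∃ i < P.natDegree, ‖z‖ ^ P.natDegree ≤ ‖P.coeff i‖ * ‖z‖ ^ i := by
  have hdeg : P.natDegree ≠ 0 := fun h => by
    rw [Polynomial.eq_one_of_monic_natDegree_zero hP h, Polynomial.IsRoot.def,
      Polynomial.eval_one] at hz
    exact one_ne_zero hz
  rw [Polynomial.IsRoot.def, Polynomial.eval_eq_sum_range, Finset.sum_range_succ,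
    hP.coeff_natDegree, one_mul] at hz
  obtain ⟨i, hi, hle⟩ := IsUltrametricDist.exists_norm_finsetSum_le_of_nonempty
    (Finset.nonempty_range_iff.mpr hdeg) fun i => P.coeff i * z ^ i
  rw [eq_neg_of_add_eq_zero_left hz, norm_neg, norm_pow, norm_mul, norm_pow] at hle
  exact ⟨i, Finset.mem_range.mp hi, hle⟩

theorem norm_le_one_of_isRoot (hP : P.Monic) (hcoeff : ∀ i < P.natDegree, ‖P.coeff i‖ ≤ 1)
    (hz : P.IsRoot z) : ‖z‖ ≤ 1 := by
  obtain ⟨i, hi, hle⟩ := exists_norm_pow_natDegree_le_of_isRoot hP hz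
  by_contra! hgt
  have := hle.trans (mul_le_of_le_one_left (by positivity) (hcoeff i hi))
  exact this.not_gt (pow_lt_pow_right₀ hgt hi)

theorem norm_lt_one_of_isRoot (hP : P.Monic) (hcoeff : ∀ i < P.natDegree, ‖P.coeff i‖ < 1)
    (hz : P.IsRoot z) : ‖z‖ < 1 := by
  obtain ⟨i, hi, hle⟩ := exists_norm_pow_natDegree_le_of_isRoot hP hz
  by_contra! hge
  have hpos : 0 < ‖z‖ ^ i := pow_pos (one_pos.trans_le hge) i
  have := hle.trans_lt (mul_lt_of_lt_one_left hpos (hcoeff i hi))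
  exact this.not_ge (pow_le_pow_right₀ hge hi.le)

end RootBounds

section Prepared

open Filter PowerSeries

variable {p : ℕ} [Fact p.Prime] {K : IntermediateField ℚ_[p] ℂ_[p]} {D : Set ℂ_[p]}

/-- `F = P U` is a Weierstrass factorization on `D`: the polynomial `P` is monic over `𝒪_K` with all
its roots in `D`, and `U` is a power series with `|U(z)| = 1` on `D`. -/
structure IsPrepared (D : Set ℂ_[p]) (F : ℂ_[p]⟦X⟧) (P : Polynomial (ringInt K))
    (U : ℂ_[p]⟦X⟧) : Prop where
  monic : P.Monic
  eq_mul : F = ((P.map (incl K) : Polynomial ℂ_[p]) : ℂ_[p]⟦X⟧) * U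
  convergesOn : ConvergesOn U D
  norm_eq_one : ∀ z ∈ D, ‖evalAt U z‖ = 1
  roots_mem : ∀ z ∈ (P.map (incl K)).roots, z ∈ D

namespace IsPrepared

variable {F G U V : ℂ_[p]⟦X⟧} {P Q : Polynomial (ringInt K)}

theorem norm_evalAt (hF : IsPrepared D F P U) {z : ℂ_[p]} (hz : z ∈ D) :
    ‖evalAt F z‖ = ‖(P.map (incl K)).eval z‖ := by
  rw [hF.eq_mul, evalAt_mul (convergesAt_coe _ _) (hF.convergesOn z hz), norm_mul,
    hF.norm_eq_one z hz, mul_one, evalAt_coe]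

theorem norm_evalAt_incl (hF : IsPrepared D F P U) {y : ringInt K} (hy : incl K y ∈ D) :
    ‖evalAt F (incl K y)‖ = ‖incl K (P.eval y)‖ := by
  rw [hF.norm_evalAt hy, Polynomial.eval_map_apply]

theorem evalAt_incl_eq_zero_iff (hF : IsPrepared D F P U) {y : ringInt K} (hy : incl K y ∈ D) :
    evalAt F (incl K y) = 0 ↔ P.eval y = 0 := by
  rw [← norm_eq_zero, hF.norm_evalAt_incl hy, norm_eq_zero, incl_eq_zero]

theorem norm_prodOverZeros (hF : IsPrepared D F P U) (hG : IsPrepared D G Q V) :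
    ‖prodOverZeros D F G‖ = ‖incl K (Polynomial.resultant P Q)‖ := by
  have hmonic : (P.map (incl K)).Monic := hF.monic.map _
  have hprod : prodOverZeros D F G = ((P.map (incl K)).roots.map (evalAt G)).prod := by
    rw [hF.eq_mul]
    refine prodOverZeros_coe_mul hmonic.ne_zero hF.convergesOn (fun z hz => ?_) hF.roots_mem G
    rw [← norm_ne_zero_iff, hF.norm_eq_one z hz]
    exact one_ne_zero
  have hres := Polynomial.resultant_eq_prod_eval (P.map (incl K)) (Q.map (incl K)) Q.natDegree
    Polynomial.natDegree_map_le (IsAlgClosed.splits _)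
  rw [hmonic.leadingCoeff, one_pow, one_mul, hF.monic.natDegree_map,
    Polynomial.resultant_map_map] at hres
  rw [hprod, hres, ← coe_nnnorm, ← coe_nnnorm]
  simp_rw [← nnnormHom_apply, map_multiset_prod, Multiset.map_map]
  congr 2
  refine Multiset.map_congr rfl fun z hz => NNReal.eq ?_
  exact hG.norm_evalAt (hF.roots_mem z hz)

end IsPrepared

theorem toCp_coe (P : Polynomial (ringInt K)) :
    toCp (P : (ringInt K)⟦X⟧) = ((P.map (incl K) : Polynomial ℂ_[p]) : ℂ_[p]⟦X⟧) :=
  Polynomial.polynomial_map_coe.symm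

theorem coeff_toCp (F : (ringInt K)⟦X⟧) (i : ℕ) : coeff i (toCp F) = incl K (coeff i F) :=
  coeff_map _ _ _

theorem norm_coeff_toCp_mul_pow_le (F : (ringInt K)⟦X⟧) (i : ℕ) (z : ℂ_[p]) :
    ‖coeff i (toCp F) * z ^ i‖ ≤ ‖z‖ ^ i := by
  rw [coeff_toCp, norm_mul, norm_pow]
  exact mul_le_of_le_one_left (by positivity) (norm_incl_le_one _)

theorem norm_coeff_toCp_of_isUnit {F : (ringInt K)⟦X⟧} {i : ℕ} (hi : IsUnit (coeff i F)) :
    ‖coeff i (toCp F)‖ = 1 := by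
  rw [coeff_toCp, isUnit_iff_norm_eq_one.mp hi]

theorem convergesOn_toCp_ball (F : (ringInt K)⟦X⟧) : ConvergesOn (toCp F) (Metric.ball 0 1) :=
  fun z hz => convergesAt_iff_tendsto.mpr <|
    squeeze_zero_norm (norm_coeff_toCp_mul_pow_le F · z)
      (tendsto_pow_atTop_nhds_zero_of_lt_one (norm_nonneg _) (mem_ball_zero_iff.mp hz))

variable {π : ringInt K}

theorem exists_isPrepared_ball [FiniteDimensional ℚ_[p] K]
    (hπ : IsLocalRing.maximalIdeal (ringInt K) = Ideal.span {π}) {F : (ringInt K)⟦X⟧} {n : ℕ}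
    (hn : IsUnit (coeff n F)) :
    ∃ (P : Polynomial (ringInt K)) (U : ℂ_[p]⟦X⟧), IsPrepared (Metric.ball 0 1) (toCp F) P U := by
  have := isAdicComplete_ringInt hπ
  have hne : F.map (IsLocalRing.residue (ringInt K)) ≠ 0 := fun h => by
    have hcoeff := congrArg (coeff n) h
    rw [coeff_map, map_zero, IsLocalRing.residue_eq_zero_iff, IsLocalRing.mem_maximalIdeal]
      at hcoeff
    exact hcoeff hn
  obtain ⟨P, U, hPU⟩ := exists_isWeierstrassFactorization hne
  have hP := hPU.isDistinguishedAt.monic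
  have hU0 : ‖coeff 0 (toCp U)‖ = 1 := norm_coeff_toCp_of_isUnit <| by
    rw [coeff_zero_eq_constantCoeff_apply]
    exact isUnit_constantCoeff _ hPU.isUnit
  refine ⟨P, toCp U, hP, ?_, convergesOn_toCp_ball U, fun z hz => ?_, fun z hz => ?_⟩
  · rw [← toCp_coe, ← map_mul, ← hPU.eq_mul]
  · rw [← hU0]
    have hz1 := mem_ball_zero_iff.mp hz
    refine norm_evalAt_eq_norm_coeff_zero (convergesOn_toCp_ball U z hz) (hU0 ▸ hz1) fun i => ?_
    exact (norm_coeff_toCp_mul_pow_le U _ z).trans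
      (pow_le_of_le_one (norm_nonneg z) hz1.le i.succ_ne_zero)
  · refine mem_ball_zero_iff.mpr <| norm_lt_one_of_isRoot (hP.map _) (fun i hi => ?_)
      (Polynomial.isRoot_of_mem_roots hz)
    rw [hP.natDegree_map] at hi
    rw [Polynomial.coeff_map]
    exact mem_maximalIdeal_iff_norm_lt_one.mp (hPU.isDistinguishedAt.mem hi)

theorem isUnit_iff_not_uniformizer_dvd
    (hπ : IsLocalRing.maximalIdeal (ringInt K) = Ideal.span {π}) {x : ringInt K} :
    IsUnit x ↔ ¬ π ∣ x := by
  rw [← Ideal.mem_span_singleton, ← hπ, IsLocalRing.mem_maximalIdeal, mem_nonunits_iff, not_not]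

theorem isRestrictedAt_of_convergesOn_closedBall
    (hπ : IsLocalRing.maximalIdeal (ringInt K) = Ideal.span {π}) {F : (ringInt K)⟦X⟧}
    (hF : ConvergesOn (toCp F) (Metric.closedBall 0 1)) : IsRestrictedAt π F := by
  have hlim := convergesAt_iff_tendsto.mp (hF 1 (mem_closedBall_zero_iff.mpr norm_one.le))
  simp only [one_pow, mul_one] at hlim
  intro k
  obtain ⟨d, hd⟩ := Metric.tendsto_atTop.mp hlim _ (pow_pos (norm_uniformizer_pos hπ) k)
  refine ⟨d, fun i hi => pow_dvd_iff_norm_le.mpr ?_⟩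
  rw [← coeff_toCp, ← dist_zero_right]
  exact (hd i hi).le

theorem IsRestrictedAt.convergesOn_closedBall
    (hπ : IsLocalRing.maximalIdeal (ringInt K) = Ideal.span {π}) {F : (ringInt K)⟦X⟧}
    (hF : IsRestrictedAt π F) : ConvergesOn (toCp F) (Metric.closedBall 0 1) := by
  refine fun z hz => convergesAt_iff_tendsto.mpr (Metric.tendsto_atTop.mpr fun e he => ?_)
  obtain ⟨k, hk⟩ := exists_pow_lt_of_lt_one he (norm_uniformizer_lt_one hπ)
  obtain ⟨d, hd⟩ := hF k
  refine ⟨d, fun i hi => ?_⟩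
  calc dist (coeff i (toCp F) * z ^ i) 0
      = ‖incl K (coeff i F)‖ * ‖z‖ ^ i := by
        rw [dist_zero_right, coeff_toCp, norm_mul, norm_pow]
    _ ≤ ‖incl K (coeff i F)‖ := mul_le_of_le_one_right (norm_nonneg _)
        (pow_le_one₀ (norm_nonneg z) (mem_closedBall_zero_iff.mp hz))
    _ ≤ ‖incl K π‖ ^ k := pow_dvd_iff_norm_le.mp (hd i hi)
    _ < e := hk

theorem mem_minIndices_toCp_iff {F : (ringInt K)⟦X⟧} {n : ℕ} (hn : IsUnit (coeff n F)) {i : ℕ} :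
    i ∈ minIndices (toCp F) ↔ IsUnit (coeff i F) := by
  simp only [minIndices, Set.mem_ofPred_eq, coeff_toCp]
  rw [isUnit_iff_norm_eq_one] at *
  exact ⟨fun h => le_antisymm (norm_incl_le_one _) (hn ▸ h n),
    fun h j => h ▸ norm_incl_le_one _⟩

theorem bddAbove_minIndices_toCp (hπ : IsLocalRing.maximalIdeal (ringInt K) = Ideal.span {π})
    {F : (ringInt K)⟦X⟧} {n : ℕ} (hn : IsUnit (coeff n F)) (hF : IsRestrictedAt π F) :
    BddAbove (minIndices (toCp F)) := by
  obtain ⟨d, hd⟩ := hF 1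
  refine ⟨d, fun i hi => ?_⟩
  by_contra! hlt
  rw [mem_minIndices_toCp_iff hn, isUnit_iff_not_uniformizer_dvd hπ, ← pow_one π] at hi
  exact hi (hd i hlt.le)

theorem isUnit_coeff_lwideg (hπ : IsLocalRing.maximalIdeal (ringInt K) = Ideal.span {π})
    {F : (ringInt K)⟦X⟧} {n : ℕ} (hn : IsUnit (coeff n F)) (hF : IsRestrictedAt π F) :
    IsUnit (coeff (lwideg (toCp F)) F) :=
  (mem_minIndices_toCp_iff hn).mp <|
    Nat.sSup_mem ⟨n, (mem_minIndices_toCp_iff hn).mpr hn⟩ (bddAbove_minIndices_toCp hπ hn hF)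

theorem dvd_coeff_of_lwideg_lt (hπ : IsLocalRing.maximalIdeal (ringInt K) = Ideal.span {π})
    {F : (ringInt K)⟦X⟧} {n : ℕ} (hn : IsUnit (coeff n F)) (hF : IsRestrictedAt π F) {i : ℕ}
    (hi : lwideg (toCp F) < i) : π ∣ coeff i F := by
  by_contra hdvd
  rw [← isUnit_iff_not_uniformizer_dvd hπ, ← mem_minIndices_toCp_iff hn] at hdvd
  exact hi.not_ge (le_csSup (bddAbove_minIndices_toCp hπ hn hF) hdvd)

theorem norm_evalAt_toCp_of_dvd_sub_C
    (hπ : IsLocalRing.maximalIdeal (ringInt K) = Ideal.span {π}) {U : (ringInt K)⟦X⟧}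
    {u : ringInt K} (hu : IsUnit u) (hU : C π ∣ U - C u)
    (hconv : ConvergesOn (toCp U) (Metric.closedBall 0 1)) {z : ℂ_[p]}
    (hz : z ∈ Metric.closedBall 0 1) : ‖evalAt (toCp U) z‖ = 1 := by
  have hcoeff := powerSeries_C_dvd_iff.mp hU
  have hU0 : ‖coeff 0 (toCp U)‖ = 1 := norm_coeff_toCp_of_isUnit <| by
    have h0 := hcoeff 0
    rw [map_sub, coeff_zero_C] at h0
    rw [isUnit_iff_not_uniformizer_dvd hπ] at hu ⊢
    exact fun hdvd => hu ((dvd_sub_right hdvd).mp h0)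
  rw [← hU0]
  refine norm_evalAt_eq_norm_coeff_zero (hconv z hz) (hU0 ▸ norm_uniformizer_lt_one hπ) fun i => ?_
  have hi := hcoeff (i + 1)
  rw [map_sub, coeff_succ_C, sub_zero, dvd_iff_norm_le] at hi
  rw [coeff_toCp, norm_mul, norm_pow]
  exact (mul_le_of_le_one_right (norm_nonneg _)
    (pow_le_one₀ (norm_nonneg z) (mem_closedBall_zero_iff.mp hz))).trans hi

theorem exists_isPrepared_closedBall [FiniteDimensional ℚ_[p] K]
    (hπ : IsLocalRing.maximalIdeal (ringInt K) = Ideal.span {π}) {F : (ringInt K)⟦X⟧} {n : ℕ}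
    (hn : IsUnit (coeff n F)) (hF : IsRestrictedAt π F) :
    ∃ (P : Polynomial (ringInt K)) (U : ℂ_[p]⟦X⟧),
      IsPrepared (Metric.closedBall 0 1) (toCp F) P U := by
  have : IsAdicComplete (Ideal.span {π}) (ringInt K) := hπ ▸ isAdicComplete_ringInt hπ
  have hu := isUnit_coeff_lwideg hπ hn hF
  obtain ⟨P, U, hP, hPU, hU, hUu⟩ := exists_weierstrass_factorization_of_isRestrictedAt hF hu
    fun _ => dvd_coeff_of_lwideg_lt hπ hn hF
  have hconv := hU.convergesOn_closedBall hπ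
  refine ⟨P, toCp U, hP, ?_, hconv, fun _ => norm_evalAt_toCp_of_dvd_sub_C hπ hu hUu hconv,
    fun z hz => ?_⟩
  · rw [← toCp_coe, ← map_mul, ← hPU]
  · refine mem_closedBall_zero_iff.mpr <| norm_le_one_of_isRoot (hP.map _) (fun i _ => ?_)
      (Polynomial.isRoot_of_mem_roots hz)
    rw [Polynomial.coeff_map]
    exact norm_incl_le_one _

end Prepared

/-! ### Valuations and the extreme values of `φ` -/

section Valuations

variable {p : ℕ} [Fact p.Prime] {r : ℝ} {ϖ : ℂ_[p]} {e : ℕ}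

theorem val_anti (h0 : 0 < ‖ϖ‖) (h1 : ‖ϖ‖ < 1) {x y : ℂ_[p]} (h : ‖x‖ ≤ ‖y‖) :
    val ϖ y ≤ val ϖ x := by
  unfold val
  split_ifs with hy hx hx
  · exact le_rfl
  · rw [hy, norm_zero, norm_le_zero_iff] at h
    exact absurd h hx
  · exact le_top
  · rw [EReal.coe_le_coe_iff]
    exact div_le_div_of_nonpos_of_le (Real.log_nonpos h0.le h1.le)
      (Real.log_le_log (norm_pos_iff.mpr hx) h)

theorem val_eq_of_norm_eq_pow (hr0 : 0 < r) (hr1 : r < 1) (hϖ : ‖ϖ‖ = r ^ e) {x : ℂ_[p]} {k : ℕ}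
    (hx : ‖x‖ = r ^ k) : val ϖ x = ((k / e : ℝ) : EReal) := by
  have hx0 : x ≠ 0 := norm_pos_iff.mp (hx ▸ pow_pos hr0 k)
  rw [val, if_neg hx0, hx, hϖ, Real.log_pow, Real.log_pow,
    mul_div_mul_right _ _ (Real.log_neg hr0 hr1).ne]

theorem phi_eq_of_max_norm_eq_pow (hr0 : 0 < r) (hr1 : r < 1) (he : 0 < e) (hϖ : ‖ϖ‖ = r ^ e)
    {F G : ℂ_[p]⟦X⟧} {z : ℂ_[p]} {k : ℕ} (h : max ‖evalAt F z‖ ‖evalAt G z‖ = r ^ k) :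
    phi ϖ F G z = ((k / e : ℝ) : EReal) := by
  have h0 : 0 < ‖ϖ‖ := hϖ ▸ pow_pos hr0 e
  have h1 : ‖ϖ‖ < 1 := hϖ ▸ pow_lt_one₀ hr0.le hr1 he.ne'
  unfold phi
  rcases le_total ‖evalAt F z‖ ‖evalAt G z‖ with hle | hle
  · rw [min_eq_right (val_anti h0 h1 hle)]
    exact val_eq_of_norm_eq_pow hr0 hr1 hϖ (max_eq_right hle ▸ h)
  · rw [min_eq_left (val_anti h0 h1 hle)]
    exact val_eq_of_norm_eq_pow hr0 hr1 hϖ (max_eq_left hle ▸ h)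

theorem isMaxMin_of_isGreatest_of_isLeast (hr0 : 0 < r) (hr1 : r < 1) (he : 0 < e)
    (hϖ : ‖ϖ‖ = r ^ e) {K : IntermediateField ℚ_[p] ℂ_[p]} {D : Set ℂ_[p]} {I : Set (ringInt K)}
    (hD : D ∩ K = incl K '' I) {F G : ℂ_[p]⟦X⟧} {k : ringInt K → ℕ}
    (hk : ∀ y ∈ I, max ‖evalAt F (incl K y)‖ ‖evalAt G (incl K y)‖ = r ^ k y) {S s : ℕ}
    (hS : IsGreatest (k '' I) S) (hs : IsLeast (k '' I) s) :
    IsMaxMin K ϖ D F G (S / e) (s / e) := by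
  have himage : phi ϖ F G '' (D ∩ K) = (fun n : ℕ => ((n / e : ℝ) : EReal)) '' (k '' I) := by
    rw [hD, Set.image_image, Set.image_image]
    exact Set.image_congr fun y hy => phi_eq_of_max_norm_eq_pow hr0 hr1 he hϖ (hk y hy)
  have hmono : Monotone fun n : ℕ => ((n / e : ℝ) : EReal) := fun m n hmn =>
    EReal.coe_le_coe_iff.mpr (by gcongr)
  rw [IsMaxMin, himage]
  exact ⟨hmono.map_isGreatest hS, hmono.map_isLeast hs⟩

theorem le_val_sub_of_norm_mul_pow_le (hr0 : 0 < r) (hr1 : r < 1)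
    (hϖ : ‖ϖ‖ = r ^ e) {ρ : ℂ_[p]} {S M N : ℕ} (h : ‖ρ‖ * r ^ N ≤ r ^ (S + M)) :
    ((1 / e * ((M : ℝ) - N) : ℝ) : EReal) ≤ val ϖ ρ - ((S / e : ℝ) : EReal) := by
  rcases eq_or_ne ρ 0 with rfl | hρ
  · rw [val, if_pos rfl, EReal.top_sub_coe]
    exact le_top
  have hlog := Real.log_neg hr0 hr1
  have hρ' := norm_pos_iff.mpr hρ
  have hbound : (S + M : ℝ) - N ≤ Real.log ‖ρ‖ / Real.log r := by
    have := Real.log_le_log (mul_pos hρ' (pow_pos hr0 N)) h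
    rw [Real.log_mul hρ'.ne' (pow_pos hr0 N).ne', Real.log_pow, Real.log_pow, Nat.cast_add] at this
    rw [le_div_iff_of_neg hlog]
    linarith
  rw [val, if_neg hρ, hϖ, Real.log_pow, ← EReal.coe_sub, EReal.coe_le_coe_iff, mul_comm (e : ℝ),
    ← div_div, ← sub_div, one_div_mul_eq_div]
  exact div_le_div_of_nonneg_right (by linarith) (Nat.cast_nonneg e)

end Valuations

/-! ### The bound for prepared power series -/

section Main

open IsLocalRing

variable {p : ℕ} [Fact p.Prime] {K : IntermediateField ℚ_[p] ℂ_[p]} {π : ringInt K}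

theorem exists_max_norm_eq_pow (hπ : maximalIdeal (ringInt K) = Ideal.span {π}) {x y : ringInt K}
    (h : ¬ (x = 0 ∧ y = 0)) : ∃ k : ℕ, max ‖incl K x‖ ‖incl K y‖ = ‖incl K π‖ ^ k := by
  wlog hle : ‖incl K x‖ ≤ ‖incl K y‖ generalizing x y
  · rw [max_comm]
    exact this (fun h' => h h'.symm) (le_of_not_ge hle)
  refine ⟨multiplicity π y, ?_⟩
  rw [max_eq_right hle]
  refine norm_incl_eq_pow_multiplicity hπ fun hy => h ⟨?_, hy⟩
  rwa [hy, map_zero, norm_zero, norm_le_zero_iff, incl_eq_zero] at hle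

theorem norm_coeff_pow_mul_of_isUnit {F : (ringInt K)⟦X⟧} {n : ℕ}
    (hn : IsUnit (PowerSeries.coeff n F)) (N : ℕ) (x : ℂ_[p]) :
    ‖PowerSeries.coeff n (toCp F) ^ N * x‖ = ‖x‖ := by
  rw [norm_mul, norm_pow, norm_coeff_toCp_of_isUnit hn, one_pow, one_mul]

theorem exists_isGreatest_exponent (hπ : maximalIdeal (ringInt K) = Ideal.span {π})
    {I : Set (ringInt K)} (hI : IsCompact (incl K '' I)) (hne : I.Nonempty)
    {P Q : Polynomial (ringInt K)} {k : ringInt K → ℕ}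
    (hk : ∀ y ∈ I, max ‖incl K (P.eval y)‖ ‖incl K (Q.eval y)‖ = ‖incl K π‖ ^ k y) :
    ∃ S, IsGreatest (k '' I) S := by
  have hcont : Continuous fun z : ℂ_[p] =>
      max ‖(P.map (incl K)).eval z‖ ‖(Q.map (incl K)).eval z‖ := by fun_prop
  obtain ⟨_, ⟨y, hy, rfl⟩, hmin⟩ := hI.exists_isMinOn (hne.image _) hcont.continuousOn
  refine ⟨k y, ⟨y, hy, rfl⟩, Set.forall_mem_image.mpr fun y' hy' => ?_⟩
  have hle := isMinOn_iff.mp hmin _ ⟨y', hy', rfl⟩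
  simp only [Polynomial.eval_map_apply] at hle
  rwa [hk y hy, hk y' hy', pow_le_pow_iff_right_of_lt_one₀ (norm_uniformizer_pos hπ)
    (norm_uniformizer_lt_one hπ)] at hle

variable [FiniteDimensional ℚ_[p] K]

theorem card_quotient_span_uniformizer (hπ : maximalIdeal (ringInt K) = Ideal.span {π}) :
    Nat.card (ringInt K ⧸ Ideal.span {π}) = p ^ residueDeg K :=
  (Nat.card_congr (Ideal.quotEquivOfEq hπ).toEquiv).symm.trans card_residueField

theorem norm_resultant_mul_pow_le (hπ : maximalIdeal (ringInt K) = Ideal.span {π}) {ε : ℕ}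
    {a b : ℕ → ℕ} (gc : GaloisConnection b a)
    (ha : ∀ j, a j = ε * j + alpha p (residueDeg K) j) {P Q : Polynomial (ringInt K)}
    (hP : P.Monic) {k : ringInt K → ℕ}
    (hk : ∀ y, π ^ ε ∣ y → max ‖incl K (P.eval y)‖ ‖incl K (Q.eval y)‖ = ‖incl K π‖ ^ k y)
    {S s : ℕ} (hS : S ∈ k '' {y | π ^ ε ∣ y}) (hs : s ∈ lowerBounds (k '' {y | π ^ ε ∣ y}))
    (t : ℕ) :
    ‖incl K (Polynomial.resultant P Q)‖ * ‖incl K π‖ ^ (2 * (∑ m ∈ Finset.Icc 1 t, b m) + s)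
      ≤ ‖incl K π‖ ^ (S + ∑ m ∈ Finset.Icc 1 (s + t), b m) := by
  have hfinite : Finite (ringInt K ⧸ Ideal.span {π}) :=
    have : Finite (ringInt K ⧸ maximalIdeal (ringInt K)) := finite_residueField
    Finite.of_equiv _ (Ideal.quotEquivOfEq hπ).toEquiv
  have hr0 := (norm_uniformizer_pos hπ).le
  have hr1 := (norm_uniformizer_lt_one hπ).le
  have hdvd {n : ℕ} {y : ringInt K} (hy : π ^ ε ∣ y) (hn : n ≤ k y) :
      π ^ n ∣ P.eval y ∧ π ^ n ∣ Q.eval y := by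
    rw [pow_dvd_iff_norm_le, pow_dvd_iff_norm_le, ← max_le_iff, hk y hy]
    exact pow_le_pow_of_le_one hr0 hr1 hn
  obtain ⟨x₀, hx₀, rfl⟩ := hS
  have hk_ge (y : ringInt K) (hy : π ^ ε ∣ y) : s ≤ k y := hs ⟨y, hy, rfl⟩
  have key := pow_dvd_resultant_mul_of_finite_quotient (prime_uniformizer hπ) gc (fun j => by
      simp_rw [ha, alpha, card_quotient_span_uniformizer hπ, ← pow_mul, mul_comm (residueDeg K)])
    hP hx₀ (fun y hy => (hdvd hy (hk_ge y hy)).1) (fun y hy => (hdvd hy (hk_ge y hy)).2)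
    (hdvd hx₀ le_rfl).1 (hdvd hx₀ le_rfl).2 t
  rwa [pow_dvd_iff_norm_le, map_mul, map_pow, norm_mul, norm_pow] at key

theorem exists_isMaxMin_and_le_val (hπ : maximalIdeal (ringInt K) = Ideal.span {π}) {ε : ℕ}
    {D : Set ℂ_[p]} (hD : D ∩ K = incl K '' {y | π ^ ε ∣ y}) {a b : ℕ → ℕ}
    (gc : GaloisConnection b a) (ha : ∀ j, a j = ε * j + alpha p (residueDeg K) j)
    {F G : ℂ_[p]⟦X⟧} {P Q : Polynomial (ringInt K)} {U V : ℂ_[p]⟦X⟧}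
    (hF : IsPrepared D F P U) (hG : IsPrepared D G Q V)
    (hFG : ∀ z ∈ D ∩ (K : Set ℂ_[p]), ¬ (evalAt F z = 0 ∧ evalAt G z = 0)) {ρ : ℂ_[p]}
    (hρ : ‖ρ‖ = ‖prodOverZeros D F G‖) :
    ∃ S s : ℕ, ∀ (ϖ : ℂ_[p]) (e : ℕ), 0 < e → ‖ϖ‖ = ‖incl K π‖ ^ e →
      IsMaxMin K ϖ D F G (S / e) (s / e) ∧
      ∀ t, val ϖ ρ - ((S / e : ℝ) : EReal) ≥
        ((1 / e * (((∑ m ∈ Finset.Icc 1 (s + t), b m : ℕ) : ℝ)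
          - 2 * ((∑ m ∈ Finset.Icc 1 t, b m : ℕ) : ℝ) - s) : ℝ) : EReal) := by
  set I : Set (ringInt K) := {y | π ^ ε ∣ y}
  have hID {y : ringInt K} (hy : y ∈ I) : incl K y ∈ D ∩ (K : Set ℂ_[p]) :=
    hD ▸ Set.mem_image_of_mem _ hy
  have hpow (y : ringInt K) (hy : y ∈ I) :
      ∃ k, max ‖incl K (P.eval y)‖ ‖incl K (Q.eval y)‖ = ‖incl K π‖ ^ k := by
    refine exists_max_norm_eq_pow hπ fun h => hFG _ (hID hy) ?_
    rwa [hF.evalAt_incl_eq_zero_iff (hID hy).1, hG.evalAt_incl_eq_zero_iff (hID hy).1]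
  choose! k hk using hpow
  have hne : I.Nonempty := ⟨0, dvd_zero _⟩
  obtain ⟨S, hS⟩ := exists_isGreatest_exponent hπ (isCompact_image_incl_setOf_dvd _) hne hk
  have hs : IsLeast (k '' I) (sInf (k '' I)) :=
    ⟨Nat.sInf_mem (hne.image k), fun _ h => Nat.sInf_le h⟩
  refine ⟨S, sInf (k '' I), fun ϖ e he hϖ => ⟨?_, fun t => ?_⟩⟩
  · refine isMaxMin_of_isGreatest_of_isLeast (norm_uniformizer_pos hπ)
      (norm_uniformizer_lt_one hπ) he hϖ hD (fun y hy => ?_) hS hs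
    rw [hF.norm_evalAt_incl (hID hy).1, hG.norm_evalAt_incl (hID hy).1, hk y hy]
  · have hbound := norm_resultant_mul_pow_le hπ gc ha hF.monic hk hS.1 hs.2 t
    rw [← hF.norm_prodOverZeros hG, ← hρ] at hbound
    have := le_val_sub_of_norm_mul_pow_le (norm_uniformizer_pos hπ) (norm_uniformizer_lt_one hπ)
      hϖ hbound
    rwa [Nat.cast_add, Nat.cast_mul, Nat.cast_ofNat, ← sub_sub] at this

end Main
end PadicResultant

theorem theorem3p4 (p : ℕ) [Fact p.Prime] (K : IntermediateField ℚ_[p] ℂ_[p])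
    [FiniteDimensional ℚ_[p] K]
    (π : ringInt K) (hπ : IsLocalRing.maximalIdeal (ringInt K) = Ideal.span {π})
    (F G : (ringInt K)⟦X⟧)
    (hF : HasFiniteWideg (toCp F)) (hG : HasFiniteWideg (toCp G))
    (hFu : IsUnit (PowerSeries.coeff (wideg (toCp F)) F))
    (hGu : IsUnit (PowerSeries.coeff (wideg (toCp G)) G)) :
    -- the open unit disc
    ((∀ z ∈ Metric.ball (0 : ℂ_[p]) 1 ∩ (K : Set ℂ_[p]),
        ¬ (evalAt (toCp F) z = 0 ∧ evalAt (toCp G) z = 0)) →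
      ∃ S s : ℕ,
        -- extreme values of `φ` on the open disc of `K` for `v_π` and for `v_p`
        IsMaxMin K (incl K π) (Metric.ball 0 1) (toCp F) (toCp G) S s ∧
        IsMaxMin K (p : ℂ_[p]) (Metric.ball 0 1) (toCp F) (toCp G)
          (S / ramIndex π) (s / ramIndex π) ∧
        ∀ t : ℕ,
          val (incl K π) (resO (toCp F) (toCp G))
              - ((S : ℝ) : EReal) ≥
            (((bigB' p (residueDeg K) (s + t) : ℝ)
              - 2 * bigB' p (residueDeg K) t - s : ℝ) : EReal) ∧
          val (p : ℂ_[p]) (resO (toCp F) (toCp G))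
              - ((S / ramIndex π : ℝ) : EReal) ≥
            ((1 / ramIndex π *
              ((bigB' p (residueDeg K) (s + t) : ℝ)
              - 2 * bigB' p (residueDeg K) t - s) : ℝ) : EReal)) ∧
    -- the closed unit disc
    (ConvergesOn (toCp F) (Metric.closedBall 0 1) →
      ConvergesOn (toCp G) (Metric.closedBall 0 1) →
      (∀ z ∈ Metric.closedBall (0 : ℂ_[p]) 1 ∩ (K : Set ℂ_[p]),
        ¬ (evalAt (toCp F) z = 0 ∧ evalAt (toCp G) z = 0)) →
      ∃ S s : ℕ,
        -- extreme values of `φ` on the ring of integers of `K` for `v_π` and for `v_p`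
        IsMaxMin K (incl K π) (Metric.closedBall 0 1) (toCp F) (toCp G) S s ∧
        IsMaxMin K (p : ℂ_[p]) (Metric.closedBall 0 1) (toCp F) (toCp G)
          (S / ramIndex π) (s / ramIndex π) ∧
        ∀ t : ℕ,
          val (incl K π) (resC (toCp F) (toCp G))
              - ((S : ℝ) : EReal) ≥
            (((bigB p (residueDeg K) (s + t) : ℝ)
              - 2 * bigB p (residueDeg K) t - s : ℝ) : EReal) ∧
          val (p : ℂ_[p]) (resC (toCp F) (toCp G))
              - ((S / ramIndex π : ℝ) : EReal) ≥
            ((1 / ramIndex π *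
              ((bigB p (residueDeg K) (s + t) : ℝ)
              - 2 * bigB p (residueDeg K) t - s) : ℝ) : EReal)) := by
  have hp : ‖(p : ℂ_[p])‖ = ‖incl K π‖ ^ ramIndex π := norm_natCast_prime_eq_pow hπ
  have he := ramIndex_pos hπ
  have hone : ‖incl K π‖ = ‖incl K π‖ ^ 1 := (pow_one _).symm
  refine ⟨fun hFG => ?_, fun hFc hGc hFG => ?_⟩
  · obtain ⟨P, U, HF⟩ := exists_isPrepared_ball hπ hFu
    obtain ⟨Q, V, HG⟩ := exists_isPrepared_ball hπ hGu
    obtain ⟨S, s, H⟩ := exists_isMaxMin_and_le_val hπ (ε := 1)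
      (by rw [pow_one, ball_inter_eq_image_incl hπ]) (galoisConnection_beta' p (residueDeg K))
      (fun j => by rw [one_mul, alpha']) HF HG hFG (norm_coeff_pow_mul_of_isUnit hFu _ _)
    have Hπ := H (incl K π) 1 one_pos hone
    simp only [Nat.cast_one, div_one, one_mul] at Hπ
    exact ⟨S, s, Hπ.1, (H p _ he hp).1, fun t => ⟨Hπ.2 t, (H p _ he hp).2 t⟩⟩
  · have hFr := isRestrictedAt_of_convergesOn_closedBall hπ hFc
    obtain ⟨P, U, HF⟩ := exists_isPrepared_closedBall hπ hFu hFr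
    obtain ⟨Q, V, HG⟩ := exists_isPrepared_closedBall hπ hGu
      (isRestrictedAt_of_convergesOn_closedBall hπ hGc)
    obtain ⟨S, s, H⟩ := exists_isMaxMin_and_le_val hπ (ε := 0)
      (by rw [pow_zero, closedBall_inter_eq_image_incl])
      (galoisConnection_beta (Fact.out : p.Prime).pos (residueDeg K))
      (fun j => by rw [zero_mul, zero_add]) HF HG hFG
      (norm_coeff_pow_mul_of_isUnit (isUnit_coeff_lwideg hπ hFu hFr) _ _)
    have Hπ := H (incl K π) 1 one_pos hone
    simp only [Nat.cast_one, div_one, one_mul] at Hπ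
    exact ⟨S, s, Hπ.1, (H p _ he hp).1, fun t => ⟨Hπ.2 t, (H p _ he hp).2 t⟩⟩
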